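/- Let $\mathbb D$ be the open unit disk, $\mathbb T$ the unit circle with normalized Lebesgue measure $m$ (write $|I|=m(I)$), $H^2\subset L^2(\mathbb T)$ the Hardy space (identified with its boundary values) and $H^2_-=L^2(\mathbb T)\ominus H^2$. A closed set $E\subset\mathbb T$ with $m(E)=0$ is a Carleson set if the open arcs $I_j$ that are the components of $\mathbb T\setminus E$ satisfy $\sum_j |I_j|\log\frac1{|I_j|}<\infty$. Let $E\subset\mathbb T$ be a perfect Carleson set. Let $\varphi$ be holomorphic in $\mathbb D$ and of class $C^1$ on $\overline{\mathbb D}$, with $\varphi(0)\neq0$ and $\{z\in\mathbb T:\varphi(z)=0\}=E$. Let $$H_*=H_*(\varphi,\varphi)=\{f:\ f\varphi\in H^2,\ f\overline{\varphi}\in H^2_-\},\qquad \|f\|_{H_*}=\|f\varphi\|_{L^2(\mathbb T)},$$ where $f$ runs over measurable functions on $\mathbb T$ modulo equality almost everywhere. For $f\in H_*$ put $f(0)=(f\varphi)(0)/\varphi(0)$ and $S^*f(z)=\dfrac{f(z)-f(0)}{z}$. Let $\Lambda=\{\lambda_j\}_{j\in J}$ be a non-empty countable subset of $E$ without isolated points.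 The functions $1/(z-\lambda)$, $\lambda\in E$, belong to $H_*$; let $H_0$ be the closed linear span in $H_*$ of the functions $1/(z-\lambda_j)$, $j\in J$. Then $S^*$ maps $H_0$ boundedly into $H_0$, the operator $S^*|_{H_0}$ is hypercyclic (it has a dense orbit $\{(S^*|_{H_0})^n f\}_{n\ge0}$ for some $f\in H_0$), and $S^*|_{H_0}=U+R$ with $U$ unitary on $H_0$ and $R$ of rank one. If moreover $\Lambda$ is dense in $E$, then the spectrum and the point spectrum of $S^*|_{H_0}$ are $$\sigma(S^*|_{H_0})=\sigma_p(S^*|_{H_0})=\overline E:=\{\bar\lambda:\lambda\in E\}.$$ -/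

import Mathlib

open MeasureTheory
open scoped ComplexConjugate ENNReal

noncomputable section

/-! ### The unit circle, normalized Lebesgue measure, Carleson sets -/

instance Circle.instMeasurableSpaceBorel : MeasurableSpace Circle := borel Circle

instance Circle.instBorelSpaceBorel : BorelSpace Circle := ⟨rfl⟩

/-- Normalized Lebesgue measure `m` on the unit circle: the image of the Haar probability measure
of `ℝ / ℤ` under `t ↦ exp (2 π i t)`. -/
def circleMeasure : Measure Circle :=
  Measure.map (fun t : UnitAddCircle => t.toCircle) AddCircle.haarAddCircle

/-- The arcs complementary to `E`: the connected components of the complement of `E`. -/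
def complementaryArcs (E : Set Circle) : Set (Set Circle) :=
  {I | ∃ x ∈ Eᶜ, I = connectedComponentIn Eᶜ x}

/-- Carleson sets (sets of finite entropy): closed sets of zero Lebesgue measure on the circle
whose complementary arcs satisfy `∑ |I| log (1 / |I|) < ∞`. All terms are nonnegative. -/
def IsCarlesonSet (E : Set Circle) : Prop :=
  IsClosed E ∧ circleMeasure E = 0 ∧
    Summable fun I : complementaryArcs E =>
      circleMeasure.real (I : Set Circle) * Real.log (1 / circleMeasure.real (I : Set Circle))

/-! ### The Hardy space and its orthogonal complement, through boundary values -/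

/-- The `n`-th Fourier coefficient `∫ g(z) z⁻ⁿ dm(z)` of a function on the unit circle. -/
def circleCoeff (g : Circle → ℂ) (n : ℤ) : ℂ :=
  fourierCoeff (fun t : UnitAddCircle => g t.toCircle) n

/-- `g ∈ H²`: `g ∈ L²` with vanishing Fourier coefficients of negative index. -/
def MemHardy (g : Circle → ℂ) : Prop :=
  MemLp g 2 circleMeasure ∧ ∀ n : ℤ, n < 0 → circleCoeff g n = 0

/-- `g ∈ H²₋ = L² ⊖ H²`: `g ∈ L²` with vanishing Fourier coefficients of nonnegative index. -/
def MemHardyMinus (g : Circle → ℂ) : Prop :=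
  MemLp g 2 circleMeasure ∧ ∀ n : ℤ, 0 ≤ n → circleCoeff g n = 0

lemma measurable_toCircle : Measurable (fun t : UnitAddCircle => t.toCircle) :=
  AddCircle.continuous_toCircle.measurable

instance circleMeasure.isProbabilityMeasure : IsProbabilityMeasure circleMeasure :=
  Measure.isProbabilityMeasure_map measurable_toCircle.aemeasurable

lemma circleCoeff_congr {f g : Circle → ℂ} (h : f =ᵐ[circleMeasure] g) (n : ℤ) :
    circleCoeff f n = circleCoeff g n := by
  have h' := ae_of_ae_map measurable_toCircle.aemeasurable h
  exact congrFun (fourierCoeff_congr_ae h') n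

lemma MemHardy.congr {f g : Circle → ℂ} (hf : MemHardy f) (h : f =ᵐ[circleMeasure] g) :
    MemHardy g :=
  ⟨hf.1.ae_eq h, fun n hn => by rw [← circleCoeff_congr h, hf.2 n hn]⟩

lemma MemHardyMinus.congr {f g : Circle → ℂ} (hf : MemHardyMinus f)
    (h : f =ᵐ[circleMeasure] g) : MemHardyMinus g :=
  ⟨hf.1.ae_eq h, fun n hn => by rw [← circleCoeff_congr h, hf.2 n hn]⟩

lemma circleCoeff_add {f g : Circle → ℂ} (hf : MemLp f 2 circleMeasure)
    (hg : MemLp g 2 circleMeasure) (n : ℤ) :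
    circleCoeff (f + g) n = circleCoeff f n + circleCoeff g n := by
  have hf' : Integrable (fun t : UnitAddCircle => f t.toCircle) AddCircle.haarAddCircle :=
    (hf.integrable (by norm_num)).comp_measurable measurable_toCircle
  have hg' : Integrable (fun t : UnitAddCircle => g t.toCircle) AddCircle.haarAddCircle :=
    (hg.integrable (by norm_num)).comp_measurable measurable_toCircle
  exact congrFun (fourierCoeff.add hf' hg') n

lemma circleCoeff_smul (c : ℂ) (f : Circle → ℂ) (n : ℤ) :
    circleCoeff (c • f) n = c * circleCoeff f n :=
  fourierCoeff.const_mul _ c n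

lemma MemHardy.add {f g : Circle → ℂ} (hf : MemHardy f) (hg : MemHardy g) : MemHardy (f + g) :=
  ⟨hf.1.add hg.1, fun n hn => by
    rw [circleCoeff_add hf.1 hg.1, hf.2 n hn, hg.2 n hn, add_zero]⟩

lemma MemHardyMinus.add {f g : Circle → ℂ} (hf : MemHardyMinus f) (hg : MemHardyMinus g) :
    MemHardyMinus (f + g) :=
  ⟨hf.1.add hg.1, fun n hn => by
    rw [circleCoeff_add hf.1 hg.1, hf.2 n hn, hg.2 n hn, add_zero]⟩

lemma MemHardy.smul (c : ℂ) {f : Circle → ℂ} (hf : MemHardy f) : MemHardy (c • f) :=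
  ⟨hf.1.const_smul c, fun n hn => by rw [circleCoeff_smul, hf.2 n hn, mul_zero]⟩

lemma MemHardyMinus.smul (c : ℂ) {f : Circle → ℂ} (hf : MemHardyMinus f) :
    MemHardyMinus (c • f) :=
  ⟨hf.1.const_smul c, fun n hn => by rw [circleCoeff_smul, hf.2 n hn, mul_zero]⟩

/-! ### The space `H_*(φ, φ)` -/

/-- The restriction to the unit circle of a function continuous on the closed unit disk. -/
def boundaryValues (φ : ℂ → ℂ) (hφ : ContinuousOn φ (Metric.closedBall 0 1)) : C(Circle, ℂ) where
  toFun z := φ z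
  continuous_toFun := hφ.comp_continuous continuous_subtype_val fun z => by
    simpa using (Circle.norm_coe z).le

/-- The measure `|φ|² dm`. For `φ ≠ 0` a.e. it has the same null sets as `m`, and its `L²` space
consists of the functions `f` with `f φ ∈ L²(m)`, with the norm `‖f φ‖`. -/
def weightedMeasure (φ : C(Circle, ℂ)) : Measure Circle :=
  circleMeasure.withDensity fun z => ‖φ z‖ₑ ^ 2

lemma weighted_ae {φ : C(Circle, ℂ)} {f g : Circle → ℂ} (h : f =ᵐ[weightedMeasure φ] g)
    {b : Circle → ℂ} (hb : ∀ z, φ z = 0 → b z = 0) :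
    (fun z => f z * b z) =ᵐ[circleMeasure] fun z => g z * b z := by
  have hm : Measurable fun z => ‖φ z‖ₑ ^ 2 := (φ.continuous.measurable.enorm).pow_const 2
  have h' := (ae_withDensity_iff hm).1 h
  filter_upwards [h'] with z hz
  by_cases h0 : φ z = 0
  · simp [hb z h0]
  · rw [hz (by simpa using h0)]

/-- The space `H_*(φ, φ) = {f : f φ ∈ H², f φ̄ ∈ H²₋}` with the norm `‖f‖ = ‖f φ‖_{L²(m)}`,
as a subspace of the Hilbert space `L²(|φ|² dm)`. -/
def hstarSubmodule (φ : C(Circle, ℂ)) : Submodule ℂ (Lp ℂ 2 (weightedMeasure φ)) where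
  carrier := {f | MemHardy (fun z => f z * φ z) ∧ MemHardyMinus (fun z => f z * conj (φ z))}
  zero_mem' := by
    have h0 := Lp.coeFn_zero ℂ 2 (weightedMeasure φ)
    have hz : ∀ n, circleCoeff 0 n = 0 := fun n => by
      have := circleCoeff_smul 0 0 n
      simpa using this
    constructor
    · refine MemHardy.congr (f := 0) ⟨MemLp.zero, fun n _ => hz n⟩ ?_
      filter_upwards [weighted_ae h0 (b := fun z => φ z) fun _ h => h] with z h
      rw [h]; simp
    · refine MemHardyMinus.congr (f := 0) ⟨MemLp.zero, fun n _ => hz n⟩ ?_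
      filter_upwards [weighted_ae h0 (b := fun z => conj (φ z)) fun _ h => by simp [h]] with z h
      rw [h]; simp
  add_mem' := by
    rintro f g ⟨hf, hf'⟩ ⟨hg, hg'⟩
    have h0 := Lp.coeFn_add f g
    constructor
    · refine (hf.add hg).congr ?_
      filter_upwards [weighted_ae h0 (b := fun z => φ z) fun _ h => h] with z h
      rw [h]; simp [add_mul]
    · refine (hf'.add hg').congr ?_
      filter_upwards [weighted_ae h0 (b := fun z => conj (φ z)) fun _ h => by simp [h]] with z h
      rw [h]; simp [add_mul]
  smul_mem' := by
    rintro c f ⟨hf, hf'⟩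
    have h0 := Lp.coeFn_smul c f
    constructor
    · refine (hf.smul c).congr ?_
      filter_upwards [weighted_ae h0 (b := fun z => φ z) fun _ h => h] with z h
      rw [h]; simp [mul_assoc]
    · refine (hf'.smul c).congr ?_
      filter_upwards [weighted_ae h0 (b := fun z => conj (φ z)) fun _ h => by simp [h]] with z h
      rw [h]; simp [mul_assoc]

/-- `H_*(φ, φ)` as a space in its own right, with the inner product of `L²(|φ|² dm)`. -/
def Hstar (φ : C(Circle, ℂ)) : Type := hstarSubmodule φ

instance Hstar.instNormedAddCommGroup (φ : C(Circle, ℂ)) : NormedAddCommGroup (Hstar φ) :=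
  inferInstanceAs (NormedAddCommGroup (hstarSubmodule φ))

instance Hstar.instInnerProductSpace (φ : C(Circle, ℂ)) : InnerProductSpace ℂ (Hstar φ) :=
  inferInstanceAs (InnerProductSpace ℂ (hstarSubmodule φ))

/-- The function on the circle represented by an element of `H_*(φ, φ)`. -/
def boundaryFun {φ : C(Circle, ℂ)} (f : Hstar φ) : Circle → ℂ := (f.1 : Lp ℂ 2 (weightedMeasure φ))

/-- `f` represents the Cauchy kernel `z ↦ 1 / (z - lam)`. -/
def IsCauchyKernel {φ : C(Circle, ℂ)} (f : Hstar φ) (lam : Circle) : Prop :=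
  boundaryFun f =ᵐ[circleMeasure] fun z => 1 / ((z : ℂ) - lam)

/-- `H₀`, the closed linear span in `H_*(φ, φ)` of the functions `1 / (z - lam)`, `lam ∈ L`. -/
def cauchySpan (φ : C(Circle, ℂ)) (L : Set Circle) : Submodule ℂ (Hstar φ) :=
  (Submodule.span ℂ {f : Hstar φ | ∃ lam ∈ L, IsCauchyKernel f lam}).topologicalClosure

/-- The value `f(0)` of `f ∈ H_*(φ, φ) ⊆ H² / φ`: the value at `0` of the `H²` function `f φ`
(its zeroth Fourier coefficient) divided by `φ(0)`. -/
def valueAtZero (φ : ℂ → ℂ) (f : Circle → ℂ) : ℂ :=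
  circleCoeff (fun z => f z * φ z) 0 / φ 0

/-- The backward shift `S* f(z) = (f(z) - f(0)) / z`, on boundary values. -/
def backwardShift (φ : ℂ → ℂ) (f : Circle → ℂ) : Circle → ℂ :=
  fun z => (f z - valueAtZero φ f) / z

/-! ### Operators -/

/-- A bounded operator is hypercyclic if some orbit is dense. -/
def IsHypercyclic {X : Type*} [NormedAddCommGroup X] [NormedSpace ℂ X] (T : X →L[ℂ] X) : Prop :=
  ∃ x : X, Dense (Set.range fun n : ℕ => (T ^ n) x)

/-- `T = U + R` with `U` unitary and `R` of rank exactly one. -/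
def IsRankOnePerturbationOfUnitary {X : Type*} [NormedAddCommGroup X] [InnerProductSpace ℂ X]
    (T : X →L[ℂ] X) : Prop :=
  ∃ (U : X ≃ₗᵢ[ℂ] X) (R : X →L[ℂ] X),
    Module.finrank ℂ (LinearMap.range (R : X →ₗ[ℂ] X)) = 1 ∧ ∀ x, T x = U x + R x

/-- The point spectrum: the set of eigenvalues. -/
def pointSpectrum {X : Type*} [NormedAddCommGroup X] [NormedSpace ℂ X] (T : X →L[ℂ] X) : Set ℂ :=
  {μ | Module.End.HasEigenvalue (T : X →ₗ[ℂ] X) μ}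

end

/-! The Cauchy kernels `1/(z - l)`, `l ∈ E`, are eigenvectors of `S*` with eigenvalue `conj l`, and
they depend continuously on `l` in the norm of `H_*`, because `φ` is Lipschitz on the closed disc
and `E` is null. All three claims about the restriction of `S*` to the span of the kernels follow
from this.

Hypercyclicity needs only a continuous field of eigenvectors over a set of unimodular eigenvalues
without isolated points (`isHypercyclic_of_eigenvectors`). To steer `∑ a_l k_l` close to `∑ b_l
k_l`, add small vectors `c_l (k_{l'} - k_l)` with `l'` near `l`. Under `Tⁿ` the two eigenvalues
drift apart, and `c_l` is chosen so that the coefficient of `k_l` becomes `b_l`. One `n` must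
separate all the pairs by a gap independent of how close `l'` is to `l`;
`exists_pow_forall_le_norm_sub_one` provides it by averaging over `n`. Transitivity and Baire's
theorem then give a dense orbit.

If `f(0) = 0` then `S* f = f / z`, so `S*` is isometric on a closed hyperplane. Once it is
invertible, redefining it on the orthogonal complement of that hyperplane makes it unitary
(`isRankOnePerturbationOfUnitary_of_ker`).

Invertibility of `S* - μ` for `μ ∉ conj E`, in particular for `μ = 0`, comes from a lower bound on
finite sums of kernels (`exists_integral_sq_norm_kernelSum_le`); the range is dense because
eigenvectors span. With `g = (S* - μ) f` one has `(1 - μ z) f = f(0) + z g`, so the main point is to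
control `f(0)` by `g`. For `|μ| > 1`, evaluate at `1/μ`. For `|μ| < 1`, do the same after reflection
in the circle, which preserves both the span of the kernels and the norm. For `|μ| = 1`, the
identity `∫ (φ/φ̄) |f φ|² dm = 0` prevents mass from concentrating at `w = conj μ`, and evaluation
at `r w` with `r` close to `1` controls `f(0)` up to an absorbable error.

When `L` is dense in `E`, continuity puts all kernels with poles in `E` into `H₀`, so every point of
`conj E` is an eigenvalue. -/

noncomputable section

/-! ### Simultaneous separation of powers of unimodular numbers from 1 -/

/-- Geometric sums with unimodular ratio `ζ ≠ 1` are bounded. -/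
lemma norm_sum_pow_le_of_norm_eq_one {ζ : ℂ} (hζ : ‖ζ‖ = 1) (h1 : ζ ≠ 1) (N : ℕ) :
    ‖∑ n ∈ Finset.range N, ζ ^ n‖ ≤ 2 / ‖ζ - 1‖ := by
  rw [geom_sum_eq h1, norm_div]
  gcongr
  calc ‖ζ ^ N - 1‖ ≤ ‖ζ ^ N‖ + ‖(1 : ℂ)‖ := norm_sub_le _ _
    _ = 2 := by simp [hζ]; norm_num

/-- The quadratic means of `∑_{a < M} ζ^{na}` are asymptotically at most `M`, unless `ζ` is a root
of unity of order less than `M`. -/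
lemma exists_sum_normSq_geom_le {ζ : ℂ} (hζ : ‖ζ‖ = 1) (M : ℕ)
    (h : ∀ j, 0 < j → j < M → ζ ^ j ≠ 1) :
    ∃ B : ℝ, ∀ N : ℕ,
      ∑ n ∈ Finset.range N, ‖∑ a ∈ Finset.range M, (ζ ^ n) ^ a‖ ^ 2 ≤ N * M + B := by
  have hcc : ζ * conj ζ = 1 := by
    rw [Complex.mul_conj, Complex.normSq_eq_norm_sq, hζ]; simp
  -- Expanding the square, the off-diagonal terms are bounded geometric sums; the diagonal ones
  -- contribute `N * M`, and their `2 / 0` in the witness is `0`.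
  refine ⟨∑ a ∈ Finset.range M, ∑ b ∈ Finset.range M, 2 / ‖ζ ^ a * conj ζ ^ b - 1‖, fun N => ?_⟩
  have e1 : ((∑ n ∈ Finset.range N, ‖∑ a ∈ Finset.range M, (ζ ^ n) ^ a‖ ^ 2 : ℝ) : ℂ)
      = ∑ a ∈ Finset.range M, ∑ b ∈ Finset.range M, ∑ n ∈ Finset.range N,
          (ζ ^ a * conj ζ ^ b) ^ n := by
    rw [Complex.ofReal_sum]
    have : ∀ n, ((‖∑ a ∈ Finset.range M, (ζ ^ n) ^ a‖ ^ 2 : ℝ) : ℂ)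
        = ∑ a ∈ Finset.range M, ∑ b ∈ Finset.range M, (ζ ^ a * conj ζ ^ b) ^ n := by
      intro n
      rw [← Complex.normSq_eq_norm_sq, ← Complex.mul_conj, map_sum, Finset.sum_mul_sum]
      refine Finset.sum_congr rfl fun a _ => Finset.sum_congr rfl fun b _ => ?_
      simp only [map_pow]
      rw [mul_pow, ← pow_mul, ← pow_mul, ← pow_mul, ← pow_mul, mul_comm n a, mul_comm n b]
    simp_rw [this]
    rw [Finset.sum_comm]
    refine Finset.sum_congr rfl fun a _ => Finset.sum_comm
  have e2 : ∀ a ∈ Finset.range M, ∀ b ∈ Finset.range M,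
      ‖∑ n ∈ Finset.range N, (ζ ^ a * conj ζ ^ b) ^ n‖
        ≤ (if a = b then (N : ℝ) else 0) + 2 / ‖ζ ^ a * conj ζ ^ b - 1‖ := by
    intro a ha b hb
    by_cases hab : a = b
    · subst hab
      simp [← mul_pow, hcc]
    · rw [if_neg hab, zero_add]
      refine norm_sum_pow_le_of_norm_eq_one (by simp [hζ]) ?_ N
      intro h1
      rw [Finset.mem_range] at ha hb
      have h2 : ζ ^ a = ζ ^ b := by
        calc ζ ^ a = ζ ^ a * (ζ * conj ζ) ^ b := by rw [hcc]; simp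
          _ = (ζ ^ a * conj ζ ^ b) * ζ ^ b := by rw [mul_pow]; ring
          _ = ζ ^ b := by rw [h1, one_mul]
      have h0 : ζ ≠ 0 := by rintro rfl; simp at hζ
      rcases lt_or_gt_of_ne hab with hlt | hlt
      · apply h (b - a) (by omega) (by omega)
        have : ζ ^ b = ζ ^ a * ζ ^ (b - a) := by rw [← pow_add]; congr 1; omega
        rw [this] at h2
        exact (mul_eq_left₀ (pow_ne_zero a h0)).1 h2.symm
      · apply h (a - b) (by omega) (by omega)
        have : ζ ^ a = ζ ^ b * ζ ^ (a - b) := by rw [← pow_add]; congr 1; omega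
        rw [this] at h2
        exact (mul_eq_left₀ (pow_ne_zero b h0)).1 h2
  have e3 : (∑ n ∈ Finset.range N, ‖∑ a ∈ Finset.range M, (ζ ^ n) ^ a‖ ^ 2 : ℝ)
      = ‖((∑ n ∈ Finset.range N, ‖∑ a ∈ Finset.range M, (ζ ^ n) ^ a‖ ^ 2 : ℝ) : ℂ)‖ := by
    rw [Complex.norm_real, Real.norm_of_nonneg (Finset.sum_nonneg fun _ _ => by positivity)]
  rw [e3, e1]
  calc _ ≤ ∑ a ∈ Finset.range M, ∑ b ∈ Finset.range M,
        ‖∑ n ∈ Finset.range N, (ζ ^ a * conj ζ ^ b) ^ n‖ :=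
        (norm_sum_le _ _).trans (Finset.sum_le_sum fun a _ => norm_sum_le _ _)
    _ ≤ ∑ a ∈ Finset.range M, ∑ b ∈ Finset.range M,
        ((if a = b then (N : ℝ) else 0) + 2 / ‖ζ ^ a * conj ζ ^ b - 1‖) :=
        Finset.sum_le_sum fun a ha => Finset.sum_le_sum fun b hb => e2 a ha b hb
    _ = _ := by
        simp only [Finset.sum_add_distrib, Finset.sum_ite_eq]
        congr 1
        rw [Finset.sum_ite_of_true (by simp)]
        simp [mul_comm]

/-- Finitely many unimodular numbers that are not roots of unity of small order have a common
power away from `1`, quantitatively. -/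
lemma exists_pow_forall_le_norm_sub_one {ι : Type*} (s : Finset ι) (ζ : ι → ℂ)
    (hζ : ∀ i ∈ s, ‖ζ i‖ = 1) (M : ℕ) (hM : 4 * s.card < M)
    (h : ∀ i ∈ s, ∀ j, 0 < j → j < M → ζ i ^ j ≠ 1) :
    ∃ n : ℕ, ∀ i ∈ s, 1 / (M : ℝ) ≤ ‖ζ i ^ n - 1‖ := by
  by_contra! hcon
  have hM0 : (0 : ℝ) < M := by exact_mod_cast (by omega : 0 < M)
  have hB : ∀ i ∈ s, ∃ B : ℝ, ∀ N : ℕ,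
      ∑ n ∈ Finset.range N, ‖∑ a ∈ Finset.range M, (ζ i ^ n) ^ a‖ ^ 2 ≤ N * M + B :=
    fun i hi => exists_sum_normSq_geom_le (hζ i hi) M (h i hi)
  choose! B hB using hB
  -- If `ζ i ^ n` is within `1 / M` of `1`, its first `M` powers differ from `1` by at most `1 / 2`
  -- on average, so their sum has modulus at least `M / 2`.
  have low : ∀ n : ℕ, (M : ℝ) ^ 2 / 4 ≤
      ∑ i ∈ s, ‖∑ a ∈ Finset.range M, (ζ i ^ n) ^ a‖ ^ 2 := by
    intro n
    obtain ⟨i, hi, hlt⟩ := hcon n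
    refine le_trans ?_ (Finset.single_le_sum (f := fun i =>
      ‖∑ a ∈ Finset.range M, (ζ i ^ n) ^ a‖ ^ 2) (fun _ _ => by positivity) hi)
    set w := ζ i ^ n
    have hw : ‖w‖ = 1 := by simp [w, hζ i hi]
    have hpow : ∀ a : ℕ, ‖w ^ a - 1‖ ≤ a * ‖w - 1‖ := by
      intro a
      induction a with
      | zero => simp
      | succ a ih =>
        calc ‖w ^ (a + 1) - 1‖ = ‖w ^ a * (w - 1) + (w ^ a - 1)‖ := by ring_nf
          _ ≤ ‖w ^ a * (w - 1)‖ + ‖w ^ a - 1‖ := norm_add_le _ _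
          _ ≤ ‖w - 1‖ + a * ‖w - 1‖ := by
              rw [norm_mul, norm_pow, hw, one_pow, one_mul]; gcongr
          _ = _ := by push_cast; ring
    have hd : ‖∑ a ∈ Finset.range M, w ^ a - M‖ ≤ M / 2 := by
      calc ‖∑ a ∈ Finset.range M, w ^ a - M‖ = ‖∑ a ∈ Finset.range M, (w ^ a - 1)‖ := by
            simp
        _ ≤ ∑ a ∈ Finset.range M, (a : ℝ) * (1 / M) :=
            (norm_sum_le _ _).trans (Finset.sum_le_sum fun a _ => (hpow a).trans (by gcongr))
        _ = (∑ a ∈ Finset.range M, (a : ℝ)) * (1 / M) := by rw [Finset.sum_mul]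
        _ ≤ ((M : ℝ) * M / 2) * (1 / M) := by
            gcongr
            have := Finset.sum_range_id_mul_two M
            have h2 : (∑ a ∈ Finset.range M, (a : ℝ)) * 2 = M * ((M - 1 : ℕ) : ℝ) := by
              rw [← Nat.cast_sum]; exact_mod_cast this
            have h3 : ((M - 1 : ℕ) : ℝ) ≤ M := by exact_mod_cast Nat.sub_le _ _
            nlinarith
        _ = M / 2 := by field_simp
    have hn : (M : ℝ) / 2 ≤ ‖∑ a ∈ Finset.range M, w ^ a‖ := by
      have := norm_sub_norm_le (M : ℂ) (∑ a ∈ Finset.range M, w ^ a)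
      rw [norm_sub_rev, Complex.norm_natCast] at this
      linarith
    calc (M : ℝ) ^ 2 / 4 = (M / 2) ^ 2 := by ring
      _ ≤ _ := by gcongr
  -- Averaged over `n < N`, each `i` contributes at most about `M`, which contradicts the lower
  -- bound `M ^ 2 / 4` since `M > 4 * s.card`.
  have key : ∀ N : ℕ, (N : ℝ) * (M ^ 2 / 4 - s.card * M) ≤ ∑ i ∈ s, B i := by
    intro N
    have h1 : (N : ℝ) * (M ^ 2 / 4) ≤ ∑ i ∈ s, ((N : ℝ) * M + B i) :=
      calc (N : ℝ) * (M ^ 2 / 4) = ∑ n ∈ Finset.range N, (M : ℝ) ^ 2 / 4 := by simp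
        _ ≤ ∑ n ∈ Finset.range N, ∑ i ∈ s, ‖∑ a ∈ Finset.range M, (ζ i ^ n) ^ a‖ ^ 2 :=
          Finset.sum_le_sum fun n _ => low n
        _ = ∑ i ∈ s, ∑ n ∈ Finset.range N, ‖∑ a ∈ Finset.range M, (ζ i ^ n) ^ a‖ ^ 2 :=
          Finset.sum_comm
        _ ≤ _ := Finset.sum_le_sum fun i hi => hB i hi N
    rw [Finset.sum_add_distrib, Finset.sum_const, nsmul_eq_mul] at h1
    linarith
  have hpos : 0 < (M : ℝ) ^ 2 / 4 - s.card * M := by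
    have : (4 * s.card : ℝ) < M := by exact_mod_cast hM
    nlinarith
  obtain ⟨N, hN⟩ := exists_nat_gt ((∑ i ∈ s, B i) / ((M : ℝ) ^ 2 / 4 - s.card * M))
  rw [div_lt_iff₀ hpos] at hN
  exact absurd (key N) (not_le.2 hN)

lemma Circle.finite_setOf_pow_eq {j : ℕ} (hj : 0 < j) (w : Circle) :
    {z : Circle | z ^ j = w}.Finite := by
  classical
  refine Set.Finite.of_finite_image (f := fun z : Circle => (z : ℂ)) ?_
    Circle.coe_injective.injOn
  refine ((Polynomial.nthRoots j (w : ℂ)).toFinset.finite_toSet).subset ?_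
  rintro _ ⟨z, hz, rfl⟩
  simp only [Finset.mem_coe, Multiset.mem_toFinset, Polynomial.mem_nthRoots hj]
  rw [← Circle.coe_pow, hz]

/-! ### Hypercyclicity from a continuous field of eigenvectors -/

/-- A topologically transitive operator on a separable Banach space is hypercyclic. -/
lemma isHypercyclic_of_transitive {X : Type*} [NormedAddCommGroup X] [NormedSpace ℂ X]
    [CompleteSpace X] [TopologicalSpace.SeparableSpace X] (T : X →L[ℂ] X)
    (h : ∀ U V : Set X, IsOpen U → IsOpen V → U.Nonempty → V.Nonempty →
      ∃ n : ℕ, ∃ x ∈ U, (T ^ n) x ∈ V) : IsHypercyclic T := by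
  have : SecondCountableTopology X := UniformSpace.secondCountable_of_separable X
  set b := TopologicalSpace.countableBasis X
  have hb := TopologicalSpace.isBasis_countableBasis X
  have hcount : b.Countable := TopologicalSpace.countable_countableBasis X
  -- Baire: the vectors whose orbit meets every basic open set form a dense `G_δ`.
  have hd : Dense (⋂ V ∈ b, ⋃ n : ℕ, (fun x => (T ^ n) x) ⁻¹' V) := by
    refine dense_biInter_of_isOpen (fun V hV => isOpen_iUnion fun n =>
      (hb.isOpen hV).preimage (T ^ n).continuous) hcount fun V hV => ?_
    rw [dense_iff_inter_open]
    intro U hU hUne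
    obtain ⟨n, x, hxU, hxV⟩ := h U V hU (hb.isOpen hV) hUne
      (TopologicalSpace.nonempty_of_mem_countableBasis hV)
    exact ⟨x, hxU, Set.mem_iUnion.2 ⟨n, hxV⟩⟩
  obtain ⟨x, hx⟩ := hd.nonempty
  refine ⟨x, hb.dense_iff.2 fun V hV _ => ?_⟩
  have := Set.mem_iInter₂.1 hx V hV
  obtain ⟨n, hn⟩ := Set.mem_iUnion.1 this
  exact ⟨(T ^ n) x, hn, n, rfl⟩

/-- An operator with a continuous field of eigenvectors spanning a dense subspace, defined on a
countable set of unimodular eigenvalues without isolated points, is hypercyclic. -/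
theorem isHypercyclic_of_eigenvectors {X : Type*} [NormedAddCommGroup X] [NormedSpace ℂ X]
    [CompleteSpace X] (T : X →L[ℂ] X) {L : Set Circle} (hc : L.Countable) (hL : Preperfect L)
    (k : Circle → X) (hk : ContinuousOn k L)
    (hT : ∀ l ∈ L, T (k l) = conj (l : ℂ) • k l)
    (hd : Dense (Submodule.span ℂ (k '' L) : Set X)) : IsHypercyclic T := by
  classical
  have : TopologicalSpace.SeparableSpace X := by
    have h1 : TopologicalSpace.IsSeparable (Submodule.span ℂ (k '' L) : Set X) :=
      (hc.image k).isSeparable.span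
    have h2 := h1.closure
    rw [hd.closure_eq] at h2
    exact TopologicalSpace.isSeparable_univ_iff.1 h2
  have hTn : ∀ (n : ℕ), ∀ l ∈ L, (T ^ n) (k l) = (conj (l : ℂ)) ^ n • k l := by
    intro n l hl
    induction n with
    | zero => simp
    | succ n ih =>
      rw [pow_succ', mul_apply_eq_comp, ih, map_smul, hT l hl, smul_smul, pow_succ]
  refine isHypercyclic_of_transitive T fun U V hU hV hUne hVne => ?_
  obtain ⟨x, hx, hxU⟩ := hd.exists_mem_open hU hUne
  obtain ⟨y, hy, hyV⟩ := hd.exists_mem_open hV hVne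
  obtain ⟨a, haL, rfl⟩ := (Finsupp.mem_span_image_iff_linearCombination ℂ).1 hx
  obtain ⟨b, hbL, rfl⟩ := (Finsupp.mem_span_image_iff_linearCombination ℂ).1 hy
  set s : Finset Circle := a.support ∪ b.support with hs
  have hsL : ∀ l ∈ s, l ∈ L := by
    intro l hl
    rcases Finset.mem_union.1 hl with h | h
    · exact (Finsupp.mem_supported ℂ a).1 haL h
    · exact (Finsupp.mem_supported ℂ b).1 hbL h
  have hxe : Finsupp.linearCombination ℂ k a = ∑ l ∈ s, a l • k l :=
    Finsupp.linearCombination_apply_of_mem_supported ℂ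
      ((Finsupp.mem_supported ℂ a).2 (by exact_mod_cast Finset.subset_union_left))
  have hye : Finsupp.linearCombination ℂ k b = ∑ l ∈ s, b l • k l :=
    Finsupp.linearCombination_apply_of_mem_supported ℂ
      ((Finsupp.mem_supported ℂ b).2 (by exact_mod_cast Finset.subset_union_right))
  rw [hxe] at hxU
  rw [hye] at hyV
  obtain ⟨ε, hε, hεU⟩ := Metric.isOpen_iff.1 hU _ hxU
  obtain ⟨δ, hδ, hδV⟩ := Metric.isOpen_iff.1 hV _ hyV
  -- `C` will bound the sum of the moduli of the correction coefficients before the nearby points `p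
  -- l` are chosen; this is what allows `η` to be fixed first.
  set M : ℕ := 4 * s.card + 1 with hM
  set C : ℝ := ∑ l ∈ s, (‖a l‖ + ‖b l‖) * M with hC
  have hC0 : 0 ≤ C := Finset.sum_nonneg fun _ _ => by positivity
  obtain ⟨η, hη, hη1, hη2⟩ : ∃ η > 0, C * η < ε ∧ C * η < δ := by
    refine ⟨min ε δ / (C + 1), by positivity, ?_, ?_⟩
    · calc C * (min ε δ / (C + 1)) = min ε δ * (C / (C + 1)) := by ring
        _ < min ε δ * 1 := by
          gcongr
          rw [div_lt_one (by positivity)]; linarith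
        _ ≤ ε := by simp
    · calc C * (min ε δ / (C + 1)) = min ε δ * (C / (C + 1)) := by ring
        _ < min ε δ * 1 := by
          gcongr
          rw [div_lt_one (by positivity)]; linarith
        _ ≤ δ := by simp
  -- Only finitely many `l'` satisfy `l' ^ j = l ^ j` for some `0 < j < M`, so an accumulation point
  -- leaves room to avoid them.
  have hnear : ∀ l ∈ s, ∃ l' ∈ L, ‖k l' - k l‖ < η ∧ ∀ j, 0 < j → j < M → l' ^ j ≠ l ^ j := by
    intro l hl
    have hacc := accPt_iff_frequently_nhdsNE.1 (hL l (hsL l hl))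
    have h1 : ∀ᶠ l' in nhdsWithin l {l}ᶜ, l' ∈ L → ‖k l' - k l‖ < η := by
      have := (hk l (hsL l hl)).eventually (Metric.ball_mem_nhds (k l) hη)
      have := (eventually_nhdsWithin_iff.1 this)
      filter_upwards [nhdsWithin_le_nhds this] with l' h h2
      simpa [dist_eq_norm] using h h2
    have h2 : ∀ᶠ l' in nhdsWithin l {l}ᶜ, ∀ j ∈ Finset.Ico 1 M, l' ^ j ≠ l ^ j := by
      rw [Filter.eventually_all_finset]
      intro j hj
      have hfin := (Circle.finite_setOf_pow_eq (Finset.mem_Ico.1 hj).1 (l ^ j)).subset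
        (Set.sdiff_subset (t := {l}))
      have hmem : ({z : Circle | z ^ j = l ^ j} \ {l})ᶜ ∈ nhds l :=
        hfin.isClosed.isOpen_compl.mem_nhds (by simp)
      filter_upwards [nhdsWithin_le_nhds hmem, self_mem_nhdsWithin] with l' h3 h4 h5
      exact h3 ⟨h5, h4⟩
    obtain ⟨l', h3, h4, h5⟩ := (hacc.and_eventually (h1.and h2)).exists
    exact ⟨l', h3, h4 h3, fun j hj1 hj2 => h5 j (Finset.mem_Ico.2 ⟨hj1, hj2⟩)⟩
  choose! p hpL hpη hp using hnear
  obtain ⟨n, hn⟩ := exists_pow_forall_le_norm_sub_one s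
    (fun l => ((p l / l : Circle) : ℂ)) (fun l _ => Circle.norm_coe _) M (by omega) (by
      intro l hl j hj1 hj2 h
      rw [← Circle.coe_pow, ← Circle.coe_one, Circle.coe_inj, div_pow, div_eq_one] at h
      exact hp l hl j hj1 hj2 h)
  have hgap : ∀ l ∈ s, 1 / (M : ℝ) ≤ ‖conj (p l : ℂ) ^ n - conj (l : ℂ) ^ n‖ := by
    intro l hl
    have h1 := hn l hl
    have h2 : ((p l / l : Circle) : ℂ) ^ n - 1 = ((p l : ℂ) ^ n - (l : ℂ) ^ n) / (l : ℂ) ^ n := by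
      rw [Circle.coe_div, div_pow, sub_div, div_self (pow_ne_zero _ (Circle.coe_ne_zero l))]
    rw [h2, norm_div, norm_pow, Circle.norm_coe, one_pow, div_one] at h1
    rwa [← map_pow, ← map_pow, ← map_sub, RCLike.norm_conj]
  have hM0 : (0 : ℝ) < M := by rw [hM]; positivity
  -- Solves `a l * conj l ^ n + c l * (conj (p l) ^ n - conj l ^ n) = b l`.
  set c : Circle → ℂ := fun l =>
    (b l - a l * conj (l : ℂ) ^ n) / (conj (p l : ℂ) ^ n - conj (l : ℂ) ^ n) with hcdef
  have hcn : ∀ l ∈ s, ‖c l‖ ≤ (‖a l‖ + ‖b l‖) * M := by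
    intro l hl
    have hg := hgap l hl
    have hpos : 0 < ‖conj (p l : ℂ) ^ n - conj (l : ℂ) ^ n‖ := lt_of_lt_of_le (by positivity) hg
    rw [hcdef, norm_div, div_le_iff₀ hpos]
    calc ‖b l - a l * conj (l : ℂ) ^ n‖ ≤ ‖b l‖ + ‖a l * conj (l : ℂ) ^ n‖ := norm_sub_le _ _
      _ = (‖a l‖ + ‖b l‖) * M * (1 / M) := by
          rw [norm_mul, norm_pow, RCLike.norm_conj, Circle.norm_coe]
          field_simp; ring
      _ ≤ _ := by gcongr
  -- Needed both for `c` and for `c` times the unimodular factors produced by `T ^ n`.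
  have hsmall : ∀ d : Circle → ℂ, (∀ l ∈ s, ‖d l‖ = ‖c l‖) →
      ‖∑ l ∈ s, d l • (k (p l) - k l)‖ ≤ C * η := by
    intro d hd
    rw [hC, Finset.sum_mul]
    refine (norm_sum_le _ _).trans (Finset.sum_le_sum fun l hl => ?_)
    rw [norm_smul, hd l hl]
    exact mul_le_mul (hcn l hl) (hpη l hl).le (norm_nonneg _) (by positivity)
  refine ⟨n, ∑ l ∈ s, a l • k l + ∑ l ∈ s, c l • (k (p l) - k l), hεU ?_, hδV ?_⟩
  · rw [Metric.mem_ball, dist_eq_norm, add_sub_cancel_left]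
    exact (hsmall c fun _ _ => rfl).trans_lt hη1
  · have : (T ^ n) (∑ l ∈ s, a l • k l + ∑ l ∈ s, c l • (k (p l) - k l))
        = ∑ l ∈ s, b l • k l + ∑ l ∈ s, (c l * conj (p l : ℂ) ^ n) • (k (p l) - k l) := by
      rw [map_add, map_sum, map_sum, ← Finset.sum_add_distrib, ← Finset.sum_add_distrib]
      refine Finset.sum_congr rfl fun l hl => ?_
      rw [map_smul, map_smul, map_sub, hTn n l (hsL l hl), hTn n (p l) (hpL l hl)]
      have hpos : conj (p l : ℂ) ^ n - conj (l : ℂ) ^ n ≠ 0 :=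
        norm_pos_iff.1 (lt_of_lt_of_le (by positivity) (hgap l hl))
      have hb : b l = a l * conj (l : ℂ) ^ n
          + c l * (conj (p l : ℂ) ^ n - conj (l : ℂ) ^ n) := by
        rw [hcdef]; field_simp; ring
      rw [hb]
      module
    rw [this, Metric.mem_ball, dist_eq_norm, add_sub_cancel_left]
    refine (hsmall _ fun l _ => ?_).trans_lt hη2
    rw [norm_mul, norm_pow, RCLike.norm_conj, Circle.norm_coe, one_pow, mul_one]

/-! ### Rank one perturbations of unitaries, and invertibility -/

/-- The unitary part: an invertible operator that is isometric on a closed hyperplane is a rank one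
perturbation of a unitary operator. -/
theorem isRankOnePerturbationOfUnitary_of_ker {X : Type*} [NormedAddCommGroup X]
    [InnerProductSpace ℂ X] [CompleteSpace X] (T : X →L[ℂ] X) (hT : Function.Bijective T)
    (ev : X →L[ℂ] ℂ) (hev : ev ≠ 0) (hiso : ∀ x, ev x = 0 → ‖T x‖ = ‖x‖) :
    IsRankOnePerturbationOfUnitary T := by
  -- Riesz representation with a normalized vector: `e` will be a unit normal to `ker ev`, and `d` a
  -- unit normal to its image under `T`.
  have unit : ∀ ℓ : X →L[ℂ] ℂ, ℓ ≠ 0 → ∃ e : X, ‖e‖ = 1 ∧ ∃ c : ℂ, c ≠ 0 ∧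
      ∀ x, ℓ x = c * inner ℂ e x := by
    intro ℓ hℓ
    set v := (InnerProductSpace.toDual ℂ X).symm ℓ with hv
    have hv0 : v ≠ 0 := by simpa [hv] using hℓ
    have hn : (‖v‖ : ℂ) ≠ 0 := by simpa using hv0
    refine ⟨(‖v‖ : ℂ)⁻¹ • v, ?_, (‖v‖ : ℂ), hn, fun x => ?_⟩
    · rw [norm_smul]; simp [hv0]
    · rw [inner_smul_left, ← InnerProductSpace.toDual_symm_apply, map_inv₀, Complex.conj_ofReal,
        mul_inv_cancel_left₀ hn]
  let Te := ContinuousLinearEquiv.ofBijective T (LinearMap.ker_eq_bot.2 hT.1)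
    (LinearMap.range_eq_top.2 hT.2)
  have hTe : ∀ x, Te x = T x := fun x => rfl
  have hTs : ∀ y, T (Te.symm y) = y := fun y => Te.apply_symm_apply y
  obtain ⟨e, he, a, ha, hea⟩ := unit ev hev
  obtain ⟨d, hd, b, hb, hdb⟩ := unit (ev.comp (Te.symm : X →L[ℂ] X)) (by
    intro h
    apply hev
    ext x
    simpa using congrArg (fun ℓ : X →L[ℂ] ℂ => ℓ (Te x)) h)
  have hee : inner ℂ e e = (1 : ℂ) := by rw [inner_self_eq_norm_sq_to_K, he]; simp
  have hdd : inner ℂ d d = (1 : ℂ) := by rw [inner_self_eq_norm_sq_to_K, hd]; simp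
  have hperp : ∀ x, inner ℂ e x = (0 : ℂ) ↔ ev x = 0 := fun x => by simp [hea x, ha]
  have hTperp : ∀ x, inner ℂ d (T x) = (0 : ℂ) ↔ ev x = 0 := fun x => by
    have h1 := hdb (T x)
    have h2 : (ev.comp (Te.symm : X →L[ℂ] X)) (T x) = ev x := by
      simp [← hTe]
    rw [h2] at h1
    simp [h1, hb]
  -- The perturbation must have rank exactly one, so `c • d` has to differ from `T e`; one of `c =
  -- 1`, `c = -1` works because `d ≠ 0`.
  obtain ⟨c, hc, hcne⟩ : ∃ c : ℂ, ‖c‖ = 1 ∧ T e ≠ c • d := by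
    by_contra! hcon
    have h1 := hcon 1 (by simp)
    have h2 := hcon (-1) (by simp)
    rw [h1, one_smul, neg_smul, one_smul, eq_neg_iff_add_eq_zero, ← two_smul ℂ] at h2
    have h3 : d = 0 := (smul_eq_zero.1 h2).resolve_left two_ne_zero
    simp [h3] at hd
  have hcc : conj c * c = 1 := by rw [Complex.conj_mul', hc]; simp
  -- `U` agrees with `T` on `ker ev` and sends `e` to `c • d`, matching orthogonal decompositions.
  set U : X →L[ℂ] X := T - (innerSL ℂ e).smulRight (T e - c • d) with hU
  have hUx : ∀ x, U x = T (x - (inner ℂ e x : ℂ) • e) + (inner ℂ e x : ℂ) • c • d := by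
    intro x
    simp only [hU, sub_apply, ContinuousLinearMap.smulRight_apply,
      innerSL_apply_apply, map_sub, map_smul]
    module
  have hz : ∀ x, ev (x - (inner ℂ e x : ℂ) • e) = 0 := fun x => by
    rw [← hperp, inner_sub_right, inner_smul_right, hee]; simp
  have hUn : ∀ x, ‖U x‖ = ‖x‖ := by
    intro x
    have h1 : ‖U x‖ ^ 2 = ‖x - (inner ℂ e x : ℂ) • e‖ ^ 2 + ‖(inner ℂ e x : ℂ)‖ ^ 2 := by
      rw [hUx, @norm_add_sq ℂ, hiso _ (hz x), norm_smul, norm_smul, hc, hd, inner_smul_right,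
        inner_smul_right, inner_eq_zero_symm.1 ((hTperp _).2 (hz x))]
      simp
    have h2 : ‖x‖ ^ 2 = ‖x - (inner ℂ e x : ℂ) • e‖ ^ 2 + ‖(inner ℂ e x : ℂ)‖ ^ 2 := by
      conv_lhs => rw [← sub_add_cancel x ((inner ℂ e x : ℂ) • e)]
      rw [@norm_add_sq ℂ, norm_smul, he, inner_smul_right,
        inner_eq_zero_symm.1 ((hperp _).2 (hz x))]
      simp
    exact (sq_eq_sq₀ (norm_nonneg _) (norm_nonneg _)).1 (h1.trans h2.symm)
  have hUs : Function.Surjective U := by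
    intro y
    set u := Te.symm (y - (inner ℂ d y : ℂ) • d) with hu
    have hTu : T u = y - (inner ℂ d y : ℂ) • d := hTs _
    have hue : inner ℂ e u = (0 : ℂ) := by
      rw [hperp, ← hTperp, hTu, inner_sub_right, inner_smul_right, hdd]; simp
    refine ⟨u + ((inner ℂ d y : ℂ) * conj c) • e, ?_⟩
    have hi : (inner ℂ e (u + ((inner ℂ d y : ℂ) * conj c) • e) : ℂ) = inner ℂ d y * conj c := by
      rw [inner_add_right, hue, inner_smul_right, hee]; ring
    rw [hUx, hi, add_sub_cancel_right, hTu, smul_smul, mul_assoc, hcc, mul_one]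
    abel
  refine ⟨LinearIsometryEquiv.ofSurjective ⟨(U : X →ₗ[ℂ] X), hUn⟩ hUs,
    (innerSL ℂ e).smulRight (T e - c • d), ?_, fun x => ?_⟩
  · have hr : LinearMap.range (((innerSL ℂ e).smulRight (T e - c • d) : X →L[ℂ] X) : X →ₗ[ℂ] X)
        = ℂ ∙ (T e - c • d) := by
      ext y
      rw [LinearMap.mem_range, Submodule.mem_span_singleton]
      constructor
      · rintro ⟨x, rfl⟩
        exact ⟨inner ℂ e x, by simp⟩
      · rintro ⟨t, rfl⟩
        exact ⟨t • e, by simp [he]⟩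
    rw [hr]
    exact finrank_span_singleton (sub_ne_zero.2 hcne)
  · change T x = U x + _
    simp [hU]

/-- An operator bounded below on a dense set and with dense range is bijective. -/
lemma bijective_of_bounded_below {X : Type*} [NormedAddCommGroup X] [NormedSpace ℂ X]
    [CompleteSpace X] (A : X →L[ℂ] X) {D : Set X} (hD : Dense D) (hr : Dense (A '' D)) (C : ℝ)
    (h : ∀ x ∈ D, ‖x‖ ≤ C * ‖A x‖) : Function.Bijective A := by
  have h' : ∀ x, ‖x‖ ≤ C * ‖A x‖ := by
    intro x
    have hcl : IsClosed {x : X | ‖x‖ ≤ C * ‖A x‖} :=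
      isClosed_le continuous_norm (continuous_const.mul A.continuous.norm)
    exact hcl.closure_subset_iff.2 h (hD x)
  have hanti : AntilipschitzWith C.toNNReal A := by
    refine A.antilipschitz_of_bound fun x => (h' x).trans ?_
    gcongr
    exact Real.le_coe_toNNReal C
  refine ⟨hanti.injective, ?_⟩
  have hcl := hanti.isClosed_range A.uniformContinuous
  have hdr : Dense (Set.range A) := hr.mono (Set.image_subset_range _ _)
  rw [← Set.range_eq_univ, ← hcl.closure_eq, hdr.closure_eq]

/-! ### Integration on the circle and point evaluations -/

lemma integral_circleMeasure {F : Type*} [NormedAddCommGroup F] [NormedSpace ℝ F] (g : Circle → F) :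
    ∫ z, g z ∂circleMeasure = ∫ t : UnitAddCircle, g t.toCircle ∂AddCircle.haarAddCircle := by
  have he : MeasurableEmbedding (fun t : UnitAddCircle => t.toCircle) := by
    convert (AddCircle.homeomorphCircle (T := (1 : ℝ)) one_ne_zero).isClosedEmbedding.measurableEmbedding using 2 with t
    exact (AddCircle.homeomorphCircle_apply one_ne_zero t).symm
  exact he.integral_map g

lemma circleCoeff_eq_integral (g : Circle → ℂ) (n : ℤ) :
    circleCoeff g n = ∫ z : Circle, (z : ℂ) ^ (-n) * g z ∂circleMeasure := by
  rw [integral_circleMeasure, circleCoeff, fourierCoeff]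
  refine integral_congr_ae (Filter.Eventually.of_forall fun t => ?_)
  simp [fourier_apply, AddCircle.toCircle_zsmul, smul_eq_mul, ← Circle.coe_inv_eq_conj]

/-- Gives access to the mean value and Poisson formulas, which are stated for `Real.circleAverage`.
-/
lemma integral_circleMeasure_eq_circleAverage (G : ℂ → ℂ) :
    ∫ z : Circle, G z ∂circleMeasure = Real.circleAverage G 0 1 := by
  have h1 : ∫ z : Circle, G z ∂circleMeasure
      = fourierCoeff (fun t : UnitAddCircle => G t.toCircle) 0 := by
    rw [integral_circleMeasure, fourierCoeff]
    simp
  rw [h1, fourierCoeff_eq_intervalIntegral _ 0 0, Real.circleAverage]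
  simp only [neg_zero, fourier_zero, one_smul, div_one, zero_add]
  have h2 := intervalIntegral.smul_integral_comp_mul_left
    (fun θ => G (circleMap 0 1 θ)) (2 * Real.pi) (a := 0) (b := 1)
  rw [mul_zero, mul_one] at h2
  rw [← h2, smul_smul, inv_mul_cancel₀ (by positivity), one_smul]
  refine intervalIntegral.integral_congr fun x _ => ?_
  simp [AddCircle.toCircle_apply_mk, circleMap, Circle.coe_exp]

lemma circle_coe_mem_closedBall (z : Circle) : (z : ℂ) ∈ Metric.closedBall (0 : ℂ) 1 :=
  mem_closedBall_zero_iff.2 z.norm_coe.le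

lemma DiffContOnCl.continuous_circle {h : ℂ → ℂ} (hh : DiffContOnCl ℂ h (Metric.ball 0 1)) :
    Continuous fun z : Circle => h z :=
  hh.continuousOn_ball.comp_continuous continuous_subtype_val circle_coe_mem_closedBall

lemma integrable_circle_of_continuous {F : Type*} [NormedAddCommGroup F] {g : Circle → F}
    (hg : Continuous g) : Integrable g circleMeasure :=
  hg.integrable_of_hasCompactSupport (HasCompactSupport.of_compactSpace g)

/-- Mean value property in the disc algebra. -/
lemma DiffContOnCl.integral_circle {h : ℂ → ℂ} (hh : DiffContOnCl ℂ h (Metric.ball 0 1)) :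
    ∫ z : Circle, h z ∂circleMeasure = h 0 := by
  rw [integral_circleMeasure_eq_circleAverage]
  exact DiffContOnCl.circleAverage (by simpa using hh)

/-- Point evaluations are bounded in the `H²` norm. -/
lemma DiffContOnCl.sq_norm_mul_le_integral_circle {h : ℂ → ℂ}
    (hh : DiffContOnCl ℂ h (Metric.ball 0 1)) {a : ℂ} (ha : a ∈ Metric.ball (0 : ℂ) 1) :
    ‖h a‖ ^ 2 * (1 - ‖a‖) ≤ 2 * ∫ z : Circle, ‖h z‖ ^ 2 ∂circleMeasure := by
  have ha1 : ‖a‖ < 1 := by simpa using ha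
  -- Poisson's formula for `h²`; the kernel at `a` is at most `2 / (1 - ‖a‖)`.
  have h1 := DiffContOnCl.circleAverage_poissonKernel_smul' (hh.smul hh) ha
  rw [← integral_circleMeasure_eq_circleAverage] at h1
  have hP : ∀ z : Circle, ‖((‖(z : ℂ) - 0‖ ^ 2 - ‖a - 0‖ ^ 2) / ‖(z : ℂ) - 0 - (a - 0)‖ ^ 2) •
      (h z • h z)‖ ≤ 2 / (1 - ‖a‖) * ‖h z‖ ^ 2 := by
    intro z
    have hz : 1 - ‖a‖ ≤ ‖(z : ℂ) - a‖ := by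
      have := norm_sub_norm_le (z : ℂ) a
      rwa [Circle.norm_coe] at this
    rw [norm_smul, smul_eq_mul, norm_mul, ← sq]
    gcongr
    simp only [sub_zero, Circle.norm_coe, one_pow]
    have hnn : 0 ≤ 1 - ‖a‖ ^ 2 := by nlinarith [norm_nonneg a]
    rw [Real.norm_of_nonneg (by positivity)]
    have hpos : 0 < 1 - ‖a‖ := by linarith
    have hz2 : (1 - ‖a‖) ^ 2 ≤ ‖(z : ℂ) - a‖ ^ 2 := by gcongr
    calc (1 - ‖a‖ ^ 2) / ‖(z : ℂ) - a‖ ^ 2 ≤ (1 - ‖a‖ ^ 2) / (1 - ‖a‖) ^ 2 := by gcongr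
      _ = (1 + ‖a‖) / (1 - ‖a‖) := by field_simp; ring
      _ ≤ 2 / (1 - ‖a‖) := by gcongr; linarith
  have h2 : ‖h a • h a‖ ≤ ∫ z : Circle, 2 / (1 - ‖a‖) * ‖h z‖ ^ 2 ∂circleMeasure := by
    rw [← h1]
    exact norm_integral_le_of_norm_le
      (integrable_circle_of_continuous (continuous_const.mul (hh.continuous_circle.norm.pow 2)))
      (Filter.Eventually.of_forall hP)
  rw [smul_eq_mul, norm_mul, ← sq, integral_const_mul] at h2
  have hpos : 0 < 1 - ‖a‖ := by linarith
  calc _ ≤ (2 / (1 - ‖a‖) * ∫ z : Circle, ‖h z‖ ^ 2 ∂circleMeasure) * (1 - ‖a‖) := by gcongr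
    _ = _ := by field_simp

/-- Quotients by a nonzero function are bounded at each point of the disc, even at its zeros. -/
lemma exists_sq_norm_le_integral_circle_mul {φ : ℂ → ℂ}
    (hφ : DifferentiableOn ℂ φ (Metric.ball 0 1)) (hφ0 : φ 0 ≠ 0) {v : ℂ}
    (hv : v ∈ Metric.ball (0 : ℂ) 1) :
    ∃ C : ℝ, ∀ p H : ℂ → ℂ, DifferentiableOn ℂ p (Metric.ball 0 1) →
      DiffContOnCl ℂ H (Metric.ball 0 1) → (∀ z ∈ Metric.ball (0 : ℂ) 1, H z = p z * φ z) →
      ‖p v‖ ^ 2 ≤ C * ∫ z : Circle, ‖H z‖ ^ 2 ∂circleMeasure := by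
  have han : AnalyticOnNhd ℂ φ (Metric.ball 0 1) := hφ.analyticOnNhd Metric.isOpen_ball
  -- Zeros of `φ` are isolated, so a small circle around `v` carries a positive lower bound for
  -- `‖φ‖`. There `p = H / φ` is controlled, and the maximum principle carries the bound to `v`.
  have hne : ∀ᶠ z in nhdsWithin v {v}ᶜ, φ z ≠ 0 := by
    rcases (han v hv).eventually_eq_zero_or_eventually_ne_zero with h | h
    · exact absurd (han.eqOn_zero_of_preconnected_of_eventuallyEq_zero
        (convex_ball 0 1).isPreconnected hv h (by simp)) hφ0
    · exact h
  obtain ⟨ε, hε, hεs⟩ := Metric.mem_nhdsWithin_iff.1 hne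
  have hv1 : ‖v‖ < 1 := by simpa using hv
  set ρ := min (ε / 2) ((1 - ‖v‖) / 2) with hρ
  have hρ0 : 0 < ρ := lt_min (by linarith) (by linarith)
  have hρε : ρ < ε := (min_le_left _ _).trans_lt (by linarith)
  have hρ1 : ‖v‖ + ρ < 1 := by linarith [min_le_right (ε / 2) ((1 - ‖v‖) / 2)]
  have hnorm : ∀ z ∈ Metric.closedBall v ρ, ‖z‖ ≤ ‖v‖ + ρ := fun z hz => by
    have h1 : ‖z - v‖ ≤ ρ := by simpa [dist_eq_norm] using hz
    have h2 := norm_sub_norm_le z v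
    linarith
  have hsub : Metric.closedBall v ρ ⊆ Metric.ball 0 1 := fun z hz => by
    simpa using (hnorm z hz).trans_lt hρ1
  obtain ⟨m, hm, hmφ⟩ : ∃ m > 0, ∀ z ∈ Metric.sphere v ρ, m ≤ ‖φ z‖ := by
    obtain ⟨z₀, hz₀, hmin⟩ := (isCompact_sphere v ρ).exists_isMinOn
      (NormedSpace.sphere_nonempty.2 hρ0.le)
      (hφ.continuousOn.mono (Metric.sphere_subset_closedBall.trans hsub)).norm
    refine ⟨‖φ z₀‖, norm_pos_iff.2 (hεs ⟨?_, ?_⟩), fun z hz => hmin hz⟩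
    · exact Metric.mem_ball.2 ((Metric.mem_sphere.1 hz₀).trans_lt hρε)
    · exact Metric.ne_of_mem_sphere hz₀ hρ0.ne'
  have hpos : 0 < 1 - (‖v‖ + ρ) := by linarith
  refine ⟨2 / (1 - (‖v‖ + ρ)) / m ^ 2, fun p H hp hH hHp => ?_⟩
  set I := ∫ z : Circle, ‖H z‖ ^ 2 ∂circleMeasure with hI
  have hI0 : 0 ≤ I := integral_nonneg fun _ => by positivity
  have hpd : DiffContOnCl ℂ p (Metric.ball v ρ) :=
    (hp.mono hsub).diffContOnCl_ball subset_rfl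
  have hbd : ∀ z ∈ frontier (Metric.ball v ρ), ‖p z‖ ≤ √(2 / (1 - (‖v‖ + ρ)) / m ^ 2 * I) := by
    intro z hz
    rw [frontier_ball v hρ0.ne'] at hz
    have hzc := Metric.sphere_subset_closedBall hz
    have hzb := hsub hzc
    have h1 := hH.sq_norm_mul_le_integral_circle hzb
    rw [hHp z hzb, norm_mul, mul_pow] at h1
    refine Real.le_sqrt_of_sq_le ?_
    rw [div_div, div_mul_eq_mul_div, le_div_iff₀ (by positivity)]
    calc ‖p z‖ ^ 2 * ((1 - (‖v‖ + ρ)) * m ^ 2)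
        = ‖p z‖ ^ 2 * m ^ 2 * (1 - (‖v‖ + ρ)) := by ring
      _ ≤ ‖p z‖ ^ 2 * ‖φ z‖ ^ 2 * (1 - ‖z‖) := by
          gcongr
          · exact hmφ z hz
          · exact hnorm z hzc
      _ ≤ 2 * I := h1
  have h2 := Complex.norm_le_of_forall_mem_frontier_norm_le Metric.isBounded_ball hpd hbd
    (subset_closure (Metric.mem_ball_self hρ0))
  calc ‖p v‖ ^ 2 ≤ √(2 / (1 - (‖v‖ + ρ)) / m ^ 2 * I) ^ 2 := by gcongr
    _ = _ := Real.sq_sqrt (by positivity)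

/-! ### Difference quotients and combinations of Cauchy kernels -/

lemma continuous_circle_coe : Continuous fun z : Circle => (z : ℂ) := continuous_subtype_val

lemma Circle.conj_coe (z : Circle) : conj (z : ℂ) = (z : ℂ)⁻¹ := by
  rw [← Circle.coe_inv_eq_conj, Circle.coe_inv]

/-- The quotient `φ(z) / (z - l)`, extended by continuity to `z = l`. -/
def diffQuot (φ : ℂ → ℂ) (l : ℂ) : ℂ → ℂ :=
  Function.update (fun z => φ z / (z - l)) l (derivWithin φ (Metric.closedBall 0 1) l)

lemma diffQuot_of_ne (φ : ℂ → ℂ) {l z : ℂ} (h : z ≠ l) : diffQuot φ l z = φ z / (z - l) := by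
  simp [diffQuot, h]

lemma sub_mul_diffQuot {φ : ℂ → ℂ} {l : ℂ} (hl : φ l = 0) (z : ℂ) :
    (z - l) * diffQuot φ l z = φ z := by
  by_cases h : z = l
  · simp [h, hl]
  · rw [diffQuot_of_ne φ h, mul_div_cancel₀ _ (sub_ne_zero.2 h)]

lemma Circle.ne_of_mem_ball (l : Circle) {z : ℂ} (hz : z ∈ Metric.ball (0 : ℂ) 1) :
    z ≠ l := by
  rintro rfl
  rw [mem_ball_zero_iff, Circle.norm_coe] at hz
  exact lt_irrefl _ hz

/-- At the pole, the slopes within the closed disc converge to the derivative within that disc,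
which is the value assigned there. -/
lemma diffContOnCl_diffQuot {φ : ℂ → ℂ} (hφ : ContDiffOn ℂ 1 φ (Metric.closedBall 0 1))
    (l : Circle) (hl : φ l = 0) : DiffContOnCl ℂ (diffQuot φ l) (Metric.ball 0 1) := by
  have hd : DifferentiableOn ℂ φ (Metric.closedBall 0 1) := hφ.differentiableOn (by norm_num)
  constructor
  · have h1 : DifferentiableOn ℂ (fun z => φ z / (z - l)) (Metric.ball 0 1) :=
      (hd.mono Metric.ball_subset_closedBall).div (by fun_prop)
        fun z hz => sub_ne_zero.2 (l.ne_of_mem_ball hz)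
    exact h1.congr fun z hz => diffQuot_of_ne φ (l.ne_of_mem_ball hz)
  · rw [closure_ball 0 one_ne_zero]
    intro z hz
    by_cases h : z = l
    · subst h
      rw [diffQuot, continuousWithinAt_update_same]
      have h1 := (hd l hz).hasDerivWithinAt
      rw [hasDerivWithinAt_iff_tendsto_slope] at h1
      refine h1.congr fun w => ?_
      rw [slope_def_field, hl, sub_zero]
    · rw [diffQuot, continuousWithinAt_update_of_ne h]
      exact (hd z hz).continuousWithinAt.div (by fun_prop) (sub_ne_zero.2 h)

/-- The closed disc is convex and compact, so `φ` is Lipschitz with constant `sup |φ'|`. Uniformity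
in `l` makes this the dominating bound for continuity of the kernels in their pole. -/
lemma exists_norm_diffQuot_le {φ : ℂ → ℂ} (hφ : ContDiffOn ℂ 1 φ (Metric.closedBall 0 1)) :
    ∃ C : ℝ, 0 ≤ C ∧ ∀ l : Circle, φ l = 0 → ∀ z ∈ Metric.closedBall (0 : ℂ) 1,
      ‖diffQuot φ l z‖ ≤ C := by
  have hd : DifferentiableOn ℂ φ (Metric.closedBall 0 1) := hφ.differentiableOn (by norm_num)
  have hu : UniqueDiffOn ℂ (Metric.closedBall (0 : ℂ) 1) :=
    uniqueDiffOn_convex_of_isRCLikeNormedField (convex_closedBall 0 1)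
      (by rw [interior_closedBall _ one_ne_zero]; exact ⟨0, by simp⟩)
  have hc := hφ.continuousOn_derivWithin hu le_rfl
  obtain ⟨C, hC⟩ := (isCompact_closedBall (0 : ℂ) 1).exists_bound_of_continuousOn hc
  have hC0 : 0 ≤ C := (norm_nonneg _).trans (hC 0 (by simp))
  have hlip : LipschitzOnWith ⟨C, hC0⟩ φ (Metric.closedBall 0 1) :=
    (convex_closedBall (0 : ℂ) 1).lipschitzOnWith_of_nnnorm_derivWithin_le hd fun z hz => hC z hz
  refine ⟨C, hC0, fun l hl z hz => ?_⟩
  by_cases h : z = l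
  · rw [diffQuot, h, Function.update_self]
    exact hC l (circle_coe_mem_closedBall l)
  · rw [diffQuot_of_ne φ h, norm_div, div_le_iff₀ (norm_pos_iff.2 (sub_ne_zero.2 h))]
    have h1 := hlip.dist_le_mul z hz l (circle_coe_mem_closedBall l)
    rw [dist_eq_norm, dist_eq_norm, hl, sub_zero] at h1
    exact h1

/-- `∑ a_l φ(z) / (z - l)`, the product of `φ` and a combination of Cauchy kernels. -/
def kernelSum (φ : ℂ → ℂ) (s : Finset Circle) (a : Circle → ℂ) (z : ℂ) : ℂ :=
  ∑ l ∈ s, a l * diffQuot φ l z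

lemma diffContOnCl_kernelSum {φ : ℂ → ℂ} (hφ : ContDiffOn ℂ 1 φ (Metric.closedBall 0 1))
    {s : Finset Circle} (hs : ∀ l ∈ s, φ l = 0) (a : Circle → ℂ) :
    DiffContOnCl ℂ (kernelSum φ s a) (Metric.ball 0 1) := by
  classical
  have : kernelSum φ s a = fun z => ∑ l ∈ s, a l • diffQuot φ l z := rfl
  rw [this]
  refine Finset.induction_on' (motive := fun t =>
    DiffContOnCl ℂ (fun z => ∑ l ∈ t, a l • diffQuot φ l z) (Metric.ball 0 1)) s ?_ ?_
  · simpa using diffContOnCl_const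
  · intro l t hl _ hlt ih
    simp only [Finset.sum_insert hlt]
    exact ((diffContOnCl_diffQuot hφ l (hs l hl)).const_smul (a l)).add ih

lemma kernelSum_eq_of_mem_ball (φ : ℂ → ℂ) (s : Finset Circle) (a : Circle → ℂ) {z : ℂ}
    (hz : z ∈ Metric.ball (0 : ℂ) 1) :
    kernelSum φ s a z = (∑ l ∈ s, a l / (z - l)) * φ z := by
  rw [kernelSum, Finset.sum_mul]
  refine Finset.sum_congr rfl fun l _ => ?_
  rw [diffQuot_of_ne φ (l.ne_of_mem_ball hz)]
  ring

lemma differentiableOn_sum_div_sub (s : Finset Circle) (a : Circle → ℂ) :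
    DifferentiableOn ℂ (fun z : ℂ => ∑ l ∈ s, a l / (z - l)) (Metric.ball 0 1) :=
  DifferentiableOn.fun_sum fun l _ => (differentiableOn_const _).div (by fun_prop)
    fun _ hz => sub_ne_zero.2 (l.ne_of_mem_ball hz)

/-- The relation `(1 - μ z) f = f(0) + z (S* - μ) f`, multiplied by `φ`. -/
lemma one_sub_mul_kernelSum {φ : ℂ → ℂ} {s : Finset Circle} (hs : ∀ l ∈ s, φ l = 0)
    (a : Circle → ℂ) (μ z : ℂ) :
    (1 - μ * z) * kernelSum φ s a z = -(∑ l ∈ s, a l * conj (l : ℂ)) * φ z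
      + z * kernelSum φ s (fun l => a l * (conj (l : ℂ) - μ)) z := by
  simp only [kernelSum, Finset.mul_sum, neg_mul, Finset.sum_mul, ← Finset.sum_neg_distrib,
    ← Finset.sum_add_distrib]
  refine Finset.sum_congr rfl fun l hl => ?_
  have h1 : conj (l : ℂ) * l = 1 := by rw [Circle.conj_coe, inv_mul_cancel₀ l.coe_ne_zero]
  conv_rhs => rw [← sub_mul_diffQuot (hs l hl) z]
  linear_combination (-a l * diffQuot φ l z) * h1

/-- The conjugate relation: off the zeros, `φ` times the conjugate of a combination of Cauchy
kernels is `z` times such a combination. -/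
lemma conj_kernelSum_mul {φ : ℂ → ℂ} {s : Finset Circle} (hs : ∀ l ∈ s, φ l = 0)
    (a : Circle → ℂ) (z : Circle) (hz : φ z ≠ 0) :
    conj (kernelSum φ s a z) * φ z
      = conj (φ z) * (z * kernelSum φ s (fun l => -(conj (a l) * l)) z) := by
  simp only [kernelSum, map_sum, Finset.mul_sum, Finset.sum_mul]
  refine Finset.sum_congr rfl fun l hl => ?_
  have hne : (z : ℂ) ≠ l := fun h => hz (h ▸ hs l hl)
  rw [diffQuot_of_ne φ hne]
  simp only [map_mul, map_div₀, map_sub, Circle.conj_coe]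
  have h1 : (z : ℂ) - l ≠ 0 := sub_ne_zero.2 hne
  have h2 : (l : ℂ) - z ≠ 0 := sub_ne_zero.2 hne.symm
  have hz0 := z.coe_ne_zero
  have hl0 := l.coe_ne_zero
  have h3 : (z : ℂ)⁻¹ - (l : ℂ)⁻¹ = -((z - l) / (z * l)) := by field_simp; ring
  rw [h3]
  field_simp

lemma norm_kernelSum_conj {φ : ℂ → ℂ} {s : Finset Circle} (hs : ∀ l ∈ s, φ l = 0)
    (a : Circle → ℂ) (z : Circle) (hz : φ z ≠ 0) :
    ‖kernelSum φ s (fun l => -(conj (a l) * l)) z‖ = ‖kernelSum φ s a z‖ := by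
  have h := congrArg norm (conj_kernelSum_mul hs a z hz)
  rw [norm_mul, norm_mul, norm_mul, RCLike.norm_conj, RCLike.norm_conj, Circle.norm_coe, one_mul,
    mul_comm] at h
  exact (mul_left_cancel₀ (norm_ne_zero_iff.2 hz) h).symm

/-! ### Lower bounds for `S* - μ` on combinations of Cauchy kernels -/

variable {E : Set Circle} {φ : ℂ → ℂ}

/-- At `z = μ⁻¹` the factor `1 - μ z` vanishes, leaving `f(0) = -μ⁻¹ g(μ⁻¹)` for `g = (S* - μ) f`.
The left-hand sum is `-f(0)`. -/
lemma exists_norm_value_sq_le_of_one_lt (hφ : ContDiffOn ℂ 1 φ (Metric.closedBall 0 1))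
    (hφ0 : φ 0 ≠ 0) (hzero : ∀ z : Circle, φ z = 0 ↔ z ∈ E) {μ : ℂ} (hμ : 1 < ‖μ‖) :
    ∃ C : ℝ, ∀ (s : Finset Circle) (a : Circle → ℂ), (∀ l ∈ s, l ∈ E) →
      ‖∑ l ∈ s, a l * conj (l : ℂ)‖ ^ 2 ≤
        C * ∫ z : Circle, ‖kernelSum φ s (fun l => a l * (conj (l : ℂ) - μ)) z‖ ^ 2
          ∂circleMeasure := by
  have hd : DifferentiableOn ℂ φ (Metric.ball 0 1) :=
    (hφ.differentiableOn (by norm_num)).mono Metric.ball_subset_closedBall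
  have hμ0 : μ ≠ 0 := by rintro rfl; norm_num at hμ
  have hv : μ⁻¹ ∈ Metric.ball (0 : ℂ) 1 := by
    rw [mem_ball_zero_iff, norm_inv]; exact inv_lt_one_of_one_lt₀ hμ
  obtain ⟨C, hC⟩ := exists_sq_norm_le_integral_circle_mul hd hφ0 hv
  refine ⟨C, fun s a hs => ?_⟩
  have hs' : ∀ l ∈ s, φ l = 0 := fun l hl => (hzero l).2 (hs l hl)
  have h1 := hC _ _ (differentiableOn_sum_div_sub s fun l => a l * (conj (l : ℂ) - μ))
    (diffContOnCl_kernelSum hφ hs' _) fun z hz => kernelSum_eq_of_mem_ball φ s _ hz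
  refine le_trans ?_ h1
  have h2 : ∑ l ∈ s, a l * conj (l : ℂ)
      = μ⁻¹ * ∑ l ∈ s, a l * (conj (l : ℂ) - μ) / (μ⁻¹ - l) := by
    rw [Finset.mul_sum]
    refine Finset.sum_congr rfl fun l _ => ?_
    have hne := sub_ne_zero.2 (l.ne_of_mem_ball hv)
    have h1 : conj (l : ℂ) * l = 1 := by rw [Circle.conj_coe, inv_mul_cancel₀ l.coe_ne_zero]
    have h3 : conj (l : ℂ) - μ = μ * conj (l : ℂ) * (μ⁻¹ - l) := by
      rw [mul_sub, mul_assoc μ _ (l : ℂ), h1]; field_simp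
    rw [h3, ← mul_assoc (a l), mul_div_assoc, div_self hne, mul_one]
    field_simp
  rw [h2, norm_mul]
  have : ‖μ⁻¹‖ ≤ 1 := by simpa using (mem_ball_zero_iff.1 hv).le
  calc _ ≤ (1 * ‖∑ l ∈ s, a l * (conj (l : ℂ) - μ) / (μ⁻¹ - l)‖) ^ 2 := by gcongr
    _ = _ := by rw [one_mul]

/-- The reflected combination, with coefficients `-(conj (b l) * l)`, takes the value `-conj (f(0))`
at `conj μ`, and has the same norm as `g`. -/
lemma exists_norm_value_sq_le_of_lt_one (hφ : ContDiffOn ℂ 1 φ (Metric.closedBall 0 1))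
    (hφ0 : φ 0 ≠ 0) (hzero : ∀ z : Circle, φ z = 0 ↔ z ∈ E) (hE : circleMeasure E = 0)
    {μ : ℂ} (hμ : ‖μ‖ < 1) :
    ∃ C : ℝ, ∀ (s : Finset Circle) (a : Circle → ℂ), (∀ l ∈ s, l ∈ E) →
      ‖∑ l ∈ s, a l * conj (l : ℂ)‖ ^ 2 ≤
        C * ∫ z : Circle, ‖kernelSum φ s (fun l => a l * (conj (l : ℂ) - μ)) z‖ ^ 2
          ∂circleMeasure := by
  have hd : DifferentiableOn ℂ φ (Metric.ball 0 1) :=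
    (hφ.differentiableOn (by norm_num)).mono Metric.ball_subset_closedBall
  have hv : conj μ ∈ Metric.ball (0 : ℂ) 1 := by
    rw [mem_ball_zero_iff, RCLike.norm_conj]; exact hμ
  obtain ⟨C, hC⟩ := exists_sq_norm_le_integral_circle_mul hd hφ0 hv
  refine ⟨C, fun s a hs => ?_⟩
  have hs' : ∀ l ∈ s, φ l = 0 := fun l hl => (hzero l).2 (hs l hl)
  set b : Circle → ℂ := fun l => a l * (conj (l : ℂ) - μ) with hb
  have h1 := hC _ _ (differentiableOn_sum_div_sub s fun l => -(conj (b l) * l))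
    (diffContOnCl_kernelSum hφ hs' _) fun z hz => kernelSum_eq_of_mem_ball φ s _ hz
  have h2 : ∫ z : Circle, ‖kernelSum φ s (fun l => -(conj (b l) * l)) z‖ ^ 2 ∂circleMeasure
      = ∫ z : Circle, ‖kernelSum φ s b z‖ ^ 2 ∂circleMeasure := by
    refine integral_congr_ae ?_
    filter_upwards [measure_eq_zero_iff_ae_notMem.1 hE] with z hz
    rw [norm_kernelSum_conj hs' b z (mt (hzero z).1 hz)]
  rw [h2] at h1
  refine le_trans (le_of_eq ?_) h1
  have h3 : ∑ l ∈ s, -(conj (b l) * l) / (conj μ - l) = conj (∑ l ∈ s, a l * conj (l : ℂ)) := by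
    rw [map_sum]
    refine Finset.sum_congr rfl fun l _ => ?_
    have hne := sub_ne_zero.2 (l.ne_of_mem_ball hv)
    rw [div_eq_iff hne]
    simp only [hb, map_mul, map_sub, Complex.conj_conj]
    ring
  rw [h3, RCLike.norm_conj]

/-- On the circle `|1 - μ z| ≥ |1 - ‖μ‖| > 0`, so `(1 - μ z) f = f(0) + z g` can be divided once
`f(0)` is controlled. -/
lemma integral_sq_norm_kernelSum_le_of_norm_ne_one (hφ : ContDiffOn ℂ 1 φ (Metric.closedBall 0 1))
    (hφ0 : φ 0 ≠ 0) (hzero : ∀ z : Circle, φ z = 0 ↔ z ∈ E) (hE : circleMeasure E = 0)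
    {μ : ℂ} (hμ : ‖μ‖ ≠ 1) :
    ∃ C : ℝ, ∀ (s : Finset Circle) (a : Circle → ℂ), (∀ l ∈ s, l ∈ E) →
      ∫ z : Circle, ‖kernelSum φ s a z‖ ^ 2 ∂circleMeasure ≤
        C * ∫ z : Circle, ‖kernelSum φ s (fun l => a l * (conj (l : ℂ) - μ)) z‖ ^ 2
          ∂circleMeasure := by
  obtain ⟨C, hC⟩ : ∃ C : ℝ, ∀ (s : Finset Circle) (a : Circle → ℂ), (∀ l ∈ s, l ∈ E) →
      ‖∑ l ∈ s, a l * conj (l : ℂ)‖ ^ 2 ≤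
        C * ∫ z : Circle, ‖kernelSum φ s (fun l => a l * (conj (l : ℂ) - μ)) z‖ ^ 2
          ∂circleMeasure := by
    rcases lt_or_gt_of_ne hμ with h | h
    · exact exists_norm_value_sq_le_of_lt_one hφ hφ0 hzero hE h
    · exact exists_norm_value_sq_le_of_one_lt hφ hφ0 hzero h
  set Φ := ∫ z : Circle, ‖φ z‖ ^ 2 ∂circleMeasure with hΦ
  have hφc : Continuous fun z : Circle => φ z :=
    hφ.continuousOn.comp_continuous continuous_subtype_val circle_coe_mem_closedBall
  have hΦ0 : 0 ≤ Φ := integral_nonneg fun _ => by positivity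
  have hδ : 0 < |1 - ‖μ‖| := abs_pos.2 (sub_ne_zero.2 hμ.symm)
  refine ⟨2 * (C * Φ + 1) / |1 - ‖μ‖| ^ 2, fun s a hs => ?_⟩
  have hs' : ∀ l ∈ s, φ l = 0 := fun l hl => (hzero l).2 (hs l hl)
  have hc := hC s a hs
  set c := ∑ l ∈ s, a l * conj (l : ℂ)
  set b : Circle → ℂ := fun l => a l * (conj (l : ℂ) - μ)
  have hbc := (diffContOnCl_kernelSum hφ hs' b).continuous_circle
  have hpt : ∀ z : Circle, ‖kernelSum φ s a z‖ ^ 2 ≤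
      2 / |1 - ‖μ‖| ^ 2 * (‖c‖ ^ 2 * ‖φ z‖ ^ 2 + ‖kernelSum φ s b z‖ ^ 2) := by
    intro z
    have h1 : |1 - ‖μ‖| ≤ ‖1 - μ * z‖ := by
      have := abs_norm_sub_norm_le 1 (μ * (z : ℂ))
      rwa [norm_mul, norm_one, Circle.norm_coe, mul_one] at this
    have h2 : ‖1 - μ * z‖ * ‖kernelSum φ s a z‖ ≤ ‖c‖ * ‖φ z‖ + ‖kernelSum φ s b z‖ := by
      rw [← norm_mul, one_sub_mul_kernelSum hs' a μ z]
      refine (norm_add_le _ _).trans (le_of_eq ?_)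
      rw [norm_mul, norm_neg, norm_mul, Circle.norm_coe, one_mul]
    have h3 : |1 - ‖μ‖| * ‖kernelSum φ s a z‖ ≤ ‖c‖ * ‖φ z‖ + ‖kernelSum φ s b z‖ :=
      (mul_le_mul_of_nonneg_right h1 (norm_nonneg _)).trans h2
    rw [div_mul_eq_mul_div, le_div_iff₀ (by positivity)]
    calc ‖kernelSum φ s a z‖ ^ 2 * |1 - ‖μ‖| ^ 2 = (|1 - ‖μ‖| * ‖kernelSum φ s a z‖) ^ 2 := by ring
      _ ≤ (‖c‖ * ‖φ z‖ + ‖kernelSum φ s b z‖) ^ 2 := by gcongr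
      _ ≤ _ := by nlinarith [sq_nonneg (‖c‖ * ‖φ z‖ - ‖kernelSum φ s b z‖)]
  have hiR : Integrable (fun z : Circle =>
      2 / |1 - ‖μ‖| ^ 2 * (‖c‖ ^ 2 * ‖φ z‖ ^ 2 + ‖kernelSum φ s b z‖ ^ 2)) circleMeasure :=
    integrable_circle_of_continuous (continuous_const.mul
      ((continuous_const.mul (hφc.norm.pow 2)).add (hbc.norm.pow 2)))
  have hint := integral_mono
    (integrable_circle_of_continuous
      ((diffContOnCl_kernelSum hφ hs' a).continuous_circle.norm.pow 2)) hiR hpt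
  refine hint.trans ?_
  have i1 : Integrable (fun z : Circle => ‖c‖ ^ 2 * ‖φ z‖ ^ 2) circleMeasure :=
    integrable_circle_of_continuous (continuous_const.mul (hφc.norm.pow 2))
  have i2 : Integrable (fun z : Circle => ‖kernelSum φ s b z‖ ^ 2) circleMeasure :=
    integrable_circle_of_continuous (hbc.norm.pow 2)
  rw [integral_const_mul, integral_add i1 i2, integral_const_mul]
  set J := ∫ z : Circle, ‖kernelSum φ s b z‖ ^ 2 ∂circleMeasure
  calc _ ≤ 2 / |1 - ‖μ‖| ^ 2 * (C * J * Φ + J) := by gcongr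
    _ = _ := by ring

/-- On combinations of Cauchy kernels, `∫ (φ / φ̄) |f φ|² dm = 0`. -/
lemma integral_div_conj_mul_sq_kernelSum (hφ : ContDiffOn ℂ 1 φ (Metric.closedBall 0 1))
    (hzero : ∀ z : Circle, φ z = 0 ↔ z ∈ E) (hE : circleMeasure E = 0)
    {s : Finset Circle} (hs : ∀ l ∈ s, l ∈ E) (a : Circle → ℂ) :
    ∫ z : Circle, φ z / conj (φ z) * (‖kernelSum φ s a z‖ ^ 2 : ℝ) ∂circleMeasure = 0 := by
  have hs' : ∀ l ∈ s, φ l = 0 := fun l hl => (hzero l).2 (hs l hl)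
  have hid : DiffContOnCl ℂ (fun z : ℂ => z) (Metric.ball 0 1) := differentiable_id.diffContOnCl
  -- By the conjugate relation the integrand is almost everywhere the boundary value of `z` times
  -- two kernel sums, which vanishes at the origin.
  have h1 := (hid.smul ((diffContOnCl_kernelSum hφ hs' a).smul
    (diffContOnCl_kernelSum hφ hs' fun l => -(conj (a l) * l)))).integral_circle
  rw [zero_smul] at h1
  rw [← h1]
  refine integral_congr_ae ?_
  filter_upwards [measure_eq_zero_iff_ae_notMem.1 hE] with z hz
  have hz' : φ z ≠ 0 := mt (hzero z).1 hz
  have h2 := conj_kernelSum_mul hs' a z hz'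
  have h3 : conj (φ z) ≠ 0 := by simpa using hz'
  rw [Complex.ofReal_pow, ← Complex.mul_conj', div_mul_eq_mul_div, div_eq_iff h3]
  simp only [smul_eq_mul]
  linear_combination (kernelSum φ s a z) * h2

/-- No mass of a combination of Cauchy kernels concentrates at a point of the circle where `φ` does
not vanish. -/
lemma exists_integral_sq_kernelSum_le_of_notMem
    (hφ : ContDiffOn ℂ 1 φ (Metric.closedBall 0 1)) (hzero : ∀ z : Circle, φ z = 0 ↔ z ∈ E)
    (hE : circleMeasure E = 0) {w : Circle} (hw : w ∉ E) :
    ∃ C : ℝ, 0 ≤ C ∧ ∀ (s : Finset Circle) (a : Circle → ℂ), (∀ l ∈ s, l ∈ E) →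
      ∫ z : Circle, ‖kernelSum φ s a z‖ ^ 2 ∂circleMeasure ≤
        C * ∫ z : Circle, ‖(z : ℂ) - w‖ ^ 2 * ‖kernelSum φ s a z‖ ^ 2 ∂circleMeasure := by
  have hφc : Continuous fun z : Circle => φ z :=
    hφ.continuousOn.comp_continuous continuous_subtype_val circle_coe_mem_closedBall
  have hw0 : φ w ≠ 0 := mt (hzero w).1 hw
  set u : Circle → ℂ := fun z => φ z / conj (φ z) with hu
  have hun : ∀ z, ‖u z‖ ≤ 1 := fun z => by
    rw [hu, norm_div, RCLike.norm_conj]; exact div_self_le_one _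
  have huc : ContinuousAt u w :=
    hφc.continuousAt.div (Complex.continuous_conj.comp hφc).continuousAt (by simpa using hw0)
  have hww : (conj (u w) * u w).re = 1 := by
    rw [Complex.conj_mul', hu, norm_div, RCLike.norm_conj, div_self (norm_ne_zero_iff.2 hw0)]
    simp
  have hev : ∀ᶠ z in nhds w, 1 / 2 < (conj (u w) * u z).re := by
    have h1 : ContinuousAt (fun z => (conj (u w) * u z).re) w :=
      Complex.continuous_re.continuousAt.comp (continuousAt_const.mul huc)
    exact h1.eventually (lt_mem_nhds (by beta_reduce; rw [hww]; norm_num))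
  obtain ⟨δ, hδ, hδu⟩ := Metric.eventually_nhds_iff.1 hev
  -- After rotation, `φ/φ̄` has real part above `1 / 2` near `w` and at least `-1 = 1 / 2 - 3 / 2`
  -- elsewhere, where `|z - w| ≥ δ` pays for the loss `3 / 2`.
  refine ⟨3 / δ ^ 2, by positivity, fun s a hs => ?_⟩
  have hs' : ∀ l ∈ s, φ l = 0 := fun l hl => (hzero l).2 (hs l hl)
  have hc := (diffContOnCl_kernelSum hφ hs' a).continuous_circle
  have hI1 : Integrable (fun z : Circle => ‖kernelSum φ s a z‖ ^ 2) circleMeasure :=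
    integrable_circle_of_continuous (hc.norm.pow 2)
  have hI2 : Integrable (fun z : Circle => ‖(z : ℂ) - w‖ ^ 2 * ‖kernelSum φ s a z‖ ^ 2)
      circleMeasure :=
    integrable_circle_of_continuous
      (((continuous_circle_coe.sub continuous_const).norm.pow 2).mul (hc.norm.pow 2))
  have hum : AEStronglyMeasurable u circleMeasure :=
    (hφc.measurable.div (Complex.continuous_conj.comp hφc).measurable).aestronglyMeasurable
  have hI3 : Integrable (fun z : Circle => u z * (‖kernelSum φ s a z‖ ^ 2 : ℝ)) circleMeasure :=
    hI1.ofReal.bdd_mul hum (Filter.Eventually.of_forall hun)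
  have h0 := integral_div_conj_mul_sq_kernelSum hφ hzero hE hs a
  have h1 : ∫ z : Circle, (conj (u w) * (u z * (‖kernelSum φ s a z‖ ^ 2 : ℝ))).re ∂circleMeasure
      = 0 := by
    have := integral_re (hI3.const_mul (conj (u w)))
    simp only [RCLike.re_to_complex] at this
    rw [this, integral_const_mul]
    change (conj (u w) * ∫ z : Circle, φ z / conj (φ z) * (‖kernelSum φ s a z‖ ^ 2 : ℝ)
      ∂circleMeasure).re = 0
    rw [h0]; simp
  have hpt : ∀ z : Circle, 1 / 2 * ‖kernelSum φ s a z‖ ^ 2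
      - 3 / 2 / δ ^ 2 * (‖(z : ℂ) - w‖ ^ 2 * ‖kernelSum φ s a z‖ ^ 2) ≤
      (conj (u w) * (u z * (‖kernelSum φ s a z‖ ^ 2 : ℝ))).re := by
    intro z
    have e : (conj (u w) * (u z * (‖kernelSum φ s a z‖ ^ 2 : ℝ))).re
        = (conj (u w) * u z).re * ‖kernelSum φ s a z‖ ^ 2 := by
      rw [← mul_assoc, Complex.re_mul_ofReal]
    rw [e, ← mul_assoc, ← sub_mul]
    refine mul_le_mul_of_nonneg_right ?_ (by positivity)
    by_cases hz : dist z w < δ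
    · have h2 : 0 ≤ 3 / 2 / δ ^ 2 * ‖(z : ℂ) - w‖ ^ 2 := by positivity
      linarith [hδu hz]
    · have h2 : δ ≤ ‖(z : ℂ) - w‖ := by
        rw [← dist_eq_norm]; exact not_lt.1 hz
      have h3 : 3 / 2 ≤ 3 / 2 / δ ^ 2 * ‖(z : ℂ) - w‖ ^ 2 := by
        rw [div_mul_eq_mul_div, le_div_iff₀ (by positivity)]
        gcongr
      have h4 : -1 ≤ (conj (u w) * u z).re := by
        have h5 := (abs_le.1 (Complex.abs_re_le_norm (conj (u w) * u z))).1
        rw [norm_mul, RCLike.norm_conj] at h5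
        have h6 : ‖u w‖ * ‖u z‖ ≤ 1 := mul_le_one₀ (hun w) (norm_nonneg _) (hun z)
        linarith
      linarith
  have h2 := integral_mono ((hI1.const_mul (1 / 2)).sub (hI2.const_mul (3 / 2 / δ ^ 2)))
    (hI3.const_mul (conj (u w))).re hpt
  simp only [RCLike.re_to_complex] at h2
  rw [h1, integral_sub' (hI1.const_mul _) (hI2.const_mul _), integral_const_mul,
    integral_const_mul] at h2
  rw [div_div, mul_comm (2 : ℝ), ← div_div] at h2
  linarith

/-- Here `|1 - μ z| = |z - w|` vanishes at `w`. The weight `|z - w|²` costs only a constant by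
`exists_integral_sq_kernelSum_le_of_notMem`, and `f(0)` is read off inside the disc near `w`, where
`φ ≠ 0`. -/
lemma integral_sq_norm_kernelSum_le_of_norm_eq_one (hφ : ContDiffOn ℂ 1 φ (Metric.closedBall 0 1))
    (hzero : ∀ z : Circle, φ z = 0 ↔ z ∈ E) (hE : circleMeasure E = 0) {w : Circle} (hw : w ∉ E) :
    ∃ C : ℝ, ∀ (s : Finset Circle) (a : Circle → ℂ), (∀ l ∈ s, l ∈ E) →
      ∫ z : Circle, ‖kernelSum φ s a z‖ ^ 2 ∂circleMeasure ≤
        C * ∫ z : Circle, ‖kernelSum φ s (fun l => a l * (conj (l : ℂ) - conj (w : ℂ))) z‖ ^ 2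
          ∂circleMeasure := by
  have hφc : Continuous fun z : Circle => φ z :=
    hφ.continuousOn.comp_continuous continuous_subtype_val circle_coe_mem_closedBall
  have hw0 : φ w ≠ 0 := mt (hzero w).1 hw
  obtain ⟨K, hK0, hK⟩ := exists_integral_sq_kernelSum_le_of_notMem hφ hzero hE hw
  set Φ := ∫ z : Circle, ‖φ z‖ ^ 2 ∂circleMeasure with hΦ
  have hΦ0 : 0 ≤ Φ := integral_nonneg fun _ => by positivity
  set m := ‖φ w‖ / 2 with hm
  have hm0 : 0 < m := by have := norm_pos_iff.2 hw0; positivity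
  -- The last condition makes the coefficient of `A` in `hfin` at most `1 / 2`, so that term can be
  -- absorbed.
  obtain ⟨r, hr0, hr1, hrm, hrK⟩ : ∃ r : ℝ, 0 < r ∧ r < 1 ∧ m ≤ ‖φ (r * w)‖ ∧
      8 * K * Φ / m ^ 2 * (1 - r) ≤ 1 / 2 := by
    have hmaps : Filter.Tendsto (fun r : ℝ => (r : ℂ) * w) (nhdsWithin 1 (Set.Ioo 0 1))
        (nhdsWithin (w : ℂ) (Metric.closedBall 0 1)) := by
      refine tendsto_nhdsWithin_iff.2 ⟨?_, ?_⟩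
      · have : Continuous fun r : ℝ => (r : ℂ) * w := by fun_prop
        simpa using (this.tendsto 1).mono_left nhdsWithin_le_nhds
      · filter_upwards [self_mem_nhdsWithin] with r hr
        rw [mem_closedBall_zero_iff, norm_mul, Circle.norm_coe, mul_one, Complex.norm_real,
          Real.norm_of_nonneg hr.1.le]
        exact hr.2.le
    have h1 : ∀ᶠ r : ℝ in nhdsWithin 1 (Set.Ioo 0 1), m < ‖φ (r * w)‖ :=
      ((hφ.continuousOn w (circle_coe_mem_closedBall w)).norm.tendsto.comp hmaps).eventually
        (lt_mem_nhds (by rw [hm]; linarith))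
    have h2 : ∀ᶠ r : ℝ in nhdsWithin 1 (Set.Ioo 0 1), 8 * K * Φ / m ^ 2 * (1 - r) < 1 / 2 := by
      have : Continuous fun r : ℝ => 8 * K * Φ / m ^ 2 * (1 - r) := by fun_prop
      exact ((this.tendsto 1).mono_left nhdsWithin_le_nhds).eventually
        (gt_mem_nhds (by norm_num))
    have : (nhdsWithin (1 : ℝ) (Set.Ioo 0 1)).NeBot := right_nhdsWithin_Ioo_neBot one_pos
    have h0 : ∀ᶠ r : ℝ in nhdsWithin 1 (Set.Ioo 0 1), r ∈ Set.Ioo (0 : ℝ) 1 := self_mem_nhdsWithin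
    obtain ⟨r, h3, h4, h5⟩ := (h0.and (h1.and h2)).exists
    exact ⟨r, h3.1, h3.2, h4.le, h5.le⟩
  have h1r : 0 < 1 - r := by linarith
  refine ⟨2 * (K * (2 * Φ * (4 / (1 - r) / m ^ 2) + 2)), fun s a hs => ?_⟩
  have hs' : ∀ l ∈ s, φ l = 0 := fun l hl => (hzero l).2 (hs l hl)
  set c := ∑ l ∈ s, a l * conj (l : ℂ) with hc
  set b : Circle → ℂ := fun l => a l * (conj (l : ℂ) - conj (w : ℂ)) with hb
  have ha' := diffContOnCl_kernelSum hφ hs' a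
  have hb' := diffContOnCl_kernelSum hφ hs' b
  set A := ∫ z : Circle, ‖kernelSum φ s a z‖ ^ 2 ∂circleMeasure with hA
  set B := ∫ z : Circle, ‖kernelSum φ s b z‖ ^ 2 ∂circleMeasure with hB
  have hww : conj (w : ℂ) * w = 1 := by rw [Circle.conj_coe, inv_mul_cancel₀ w.coe_ne_zero]
  have hpt : ∀ z : Circle, ‖(z : ℂ) - w‖ ^ 2 * ‖kernelSum φ s a z‖ ^ 2 ≤
      2 * ‖c‖ ^ 2 * ‖φ z‖ ^ 2 + 2 * ‖kernelSum φ s b z‖ ^ 2 := by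
    intro z
    have h1 : ‖(z : ℂ) - w‖ = ‖1 - conj (w : ℂ) * z‖ := by
      have : (z : ℂ) - w = -(w * (1 - conj (w : ℂ) * z)) := by
        linear_combination (-(z : ℂ)) * hww
      rw [this, norm_neg, norm_mul, Circle.norm_coe, one_mul]
    have h2 : ‖(z : ℂ) - w‖ * ‖kernelSum φ s a z‖ ≤ ‖c‖ * ‖φ z‖ + ‖kernelSum φ s b z‖ := by
      rw [h1, ← norm_mul, one_sub_mul_kernelSum hs' a _ z]
      refine (norm_add_le _ _).trans (le_of_eq ?_)
      rw [norm_mul, norm_neg, norm_mul, Circle.norm_coe, one_mul]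
    calc _ = (‖(z : ℂ) - w‖ * ‖kernelSum φ s a z‖) ^ 2 := by ring
      _ ≤ (‖c‖ * ‖φ z‖ + ‖kernelSum φ s b z‖) ^ 2 := by gcongr
      _ ≤ _ := by nlinarith [sq_nonneg (‖c‖ * ‖φ z‖ - ‖kernelSum φ s b z‖)]
  have hAle : A ≤ K * (2 * ‖c‖ ^ 2 * Φ + 2 * B) := by
    refine (hK s a hs).trans ?_
    gcongr
    have i1 : Integrable (fun z : Circle => 2 * ‖c‖ ^ 2 * ‖φ z‖ ^ 2) circleMeasure :=
      integrable_circle_of_continuous (continuous_const.mul (hφc.norm.pow 2))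
    have i2 : Integrable (fun z : Circle => 2 * ‖kernelSum φ s b z‖ ^ 2) circleMeasure :=
      integrable_circle_of_continuous (continuous_const.mul (hb'.continuous_circle.norm.pow 2))
    have h1 := integral_mono (integrable_circle_of_continuous
      (((continuous_circle_coe.sub continuous_const).norm.pow 2).mul
        (ha'.continuous_circle.norm.pow 2))) (i1.add i2) hpt
    refine h1.trans (le_of_eq ?_)
    rw [integral_add' i1 i2, integral_const_mul, integral_const_mul]
  have hrw : (r : ℂ) * w ∈ Metric.ball (0 : ℂ) 1 := by
    rw [mem_ball_zero_iff, norm_mul, Circle.norm_coe, mul_one, Complex.norm_real,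
      Real.norm_of_nonneg hr0.le]
    exact hr1
  have hnrw : ‖(r : ℂ) * w‖ = r := by
    rw [norm_mul, Circle.norm_coe, mul_one, Complex.norm_real, Real.norm_of_nonneg hr0.le]
  have hea := ha'.sq_norm_mul_le_integral_circle hrw
  have heb := hb'.sq_norm_mul_le_integral_circle hrw
  rw [hnrw] at hea heb
  -- At `r w` the factor `1 - μ z` is `1 - r`; its square outweighs the `1 / (1 - r)` from point
  -- evaluation of `f φ`, leaving a small multiple of `A`.
  have hcle : ‖c‖ ^ 2 ≤ (4 * (1 - r) * A + 4 / (1 - r) * B) / m ^ 2 := by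
    have h1 := one_sub_mul_kernelSum hs' a (conj (w : ℂ)) (r * w)
    have h2 : c * φ (r * w) = r * w * kernelSum φ s b (r * w)
        - (1 - r) * kernelSum φ s a (r * w) := by
      linear_combination h1 + (r : ℂ) * kernelSum φ s a (r * w) * hww
    have h3 : ‖c‖ * ‖φ (r * w)‖ ≤ ‖kernelSum φ s b (r * w)‖
        + (1 - r) * ‖kernelSum φ s a (r * w)‖ := by
      rw [← norm_mul, h2]
      refine (norm_sub_le _ _).trans ?_
      rw [norm_mul, hnrw, norm_mul]
      have : ‖(1 : ℂ) - r‖ = 1 - r := by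
        rw [← Complex.ofReal_one, ← Complex.ofReal_sub, Complex.norm_real,
          Real.norm_of_nonneg h1r.le]
      rw [this]
      gcongr
      exact mul_le_of_le_one_left (norm_nonneg _) hr1.le
    rw [le_div_iff₀ (by positivity)]
    set x := ‖kernelSum φ s a (r * w)‖
    set y := ‖kernelSum φ s b (r * w)‖
    have h4 : y ^ 2 ≤ 2 * B / (1 - r) := by rwa [le_div_iff₀ h1r]
    calc ‖c‖ ^ 2 * m ^ 2 ≤ ‖c‖ ^ 2 * ‖φ (r * w)‖ ^ 2 := by gcongr
      _ = (‖c‖ * ‖φ (r * w)‖) ^ 2 := by ring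
      _ ≤ (y + (1 - r) * x) ^ 2 := by gcongr
      _ ≤ 2 * (1 - r) * (x ^ 2 * (1 - r)) + 2 * y ^ 2 := by
          nlinarith [sq_nonneg (y - (1 - r) * x)]
      _ ≤ 2 * (1 - r) * (2 * A) + 2 * (2 * B / (1 - r)) := by gcongr
      _ = _ := by ring
  have hA0 : 0 ≤ A := integral_nonneg fun _ => by positivity
  have hfin : A ≤ 8 * K * Φ / m ^ 2 * (1 - r) * A
      + K * (2 * Φ * (4 / (1 - r) / m ^ 2) + 2) * B := by
    calc A ≤ K * (2 * ‖c‖ ^ 2 * Φ + 2 * B) := hAle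
      _ ≤ K * (2 * ((4 * (1 - r) * A + 4 / (1 - r) * B) / m ^ 2) * Φ + 2 * B) := by gcongr
      _ = _ := by ring
  have : 8 * K * Φ / m ^ 2 * (1 - r) * A ≤ 1 / 2 * A := by gcongr
  linarith

/-- `S* - μ` is bounded below on combinations of Cauchy kernels when `conj μ ∉ E`. -/
theorem exists_integral_sq_norm_kernelSum_le (hφ : ContDiffOn ℂ 1 φ (Metric.closedBall 0 1))
    (hφ0 : φ 0 ≠ 0) (hzero : ∀ z : Circle, φ z = 0 ↔ z ∈ E) (hE : circleMeasure E = 0)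
    {μ : ℂ} (hμ : ∀ l ∈ E, conj (l : ℂ) ≠ μ) :
    ∃ C : ℝ, ∀ (s : Finset Circle) (a : Circle → ℂ), (∀ l ∈ s, l ∈ E) →
      ∫ z : Circle, ‖kernelSum φ s a z‖ ^ 2 ∂circleMeasure ≤
        C * ∫ z : Circle, ‖kernelSum φ s (fun l => a l * (conj (l : ℂ) - μ)) z‖ ^ 2
          ∂circleMeasure := by
  by_cases h : ‖μ‖ = 1
  · set w : Circle := ⟨conj μ, by simp [Submonoid.unitSphere, h]⟩ with hwdef
    have hwμ : conj (w : ℂ) = μ := Complex.conj_conj μ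
    have hw : w ∉ E := fun hw => hμ w hw hwμ
    rw [← hwμ]
    exact integral_sq_norm_kernelSum_le_of_norm_eq_one hφ hzero hE hw
  · exact integral_sq_norm_kernelSum_le_of_norm_ne_one hφ hφ0 hzero hE h

/-! ### The weighted space -/

lemma memLp_circle_of_continuous {g : Circle → ℂ} (hg : Continuous g) :
    MemLp g 2 circleMeasure :=
  hg.memLp_of_hasCompactSupport (HasCompactSupport.of_compactSpace g)

/-- The multiplier `b` is kept apart from `ψ` so that both `ψ` and its conjugate are covered. -/
lemma eLpNorm_weightedMeasure (ψ : C(Circle, ℂ)) (f : Circle → ℂ) {b : Circle → ℂ}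
    (hb : ∀ z, ‖b z‖ = ‖ψ z‖) :
    eLpNorm (fun z => f z * b z) 2 circleMeasure = eLpNorm f 2 (weightedMeasure ψ) := by
  have hm : Measurable fun z => ‖ψ z‖ₑ ^ 2 := (ψ.continuous.measurable.enorm).pow_const 2
  rw [eLpNorm_eq_lintegral_rpow_enorm_toReal (by simp) (by simp),
    eLpNorm_eq_lintegral_rpow_enorm_toReal (by simp) (by simp), weightedMeasure,
    lintegral_withDensity_eq_lintegral_mul_non_measurable _ hm
      (Filter.Eventually.of_forall fun z => ENNReal.pow_lt_top enorm_lt_top)]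
  congr 1
  refine lintegral_congr fun z => ?_
  have : ‖b z‖ₑ = ‖ψ z‖ₑ := by rw [← ofReal_norm, ← ofReal_norm, hb z]
  simp only [Pi.mul_apply, enorm_mul, this, ENNReal.toReal_ofNat, ENNReal.rpow_ofNat]
  ring

lemma Lp.memLp_weighted_mul {ψ : C(Circle, ℂ)} (f : Lp ℂ 2 (weightedMeasure ψ)) (b : C(Circle, ℂ))
    (hb : ∀ z, ‖b z‖ = ‖ψ z‖) : MemLp (fun z => f z * b z) 2 circleMeasure := by
  refine ⟨((Lp.stronglyMeasurable f).mul b.continuous.stronglyMeasurable).aestronglyMeasurable, ?_⟩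
  rw [eLpNorm_weightedMeasure ψ f hb]
  exact (Lp.memLp f).2

/-- Multiplication by a continuous function of modulus `|ψ|`, as an isometry from `L²(|ψ|² dm)` to
`L²(m)`. -/
def weightMul (ψ b : C(Circle, ℂ)) (hb : ∀ z, ‖b z‖ = ‖ψ z‖) :
    Lp ℂ 2 (weightedMeasure ψ) →ₗᵢ[ℂ] Lp ℂ 2 circleMeasure where
  toFun f := (Lp.memLp_weighted_mul f b hb).toLp
  map_add' f g := by
    rw [← MemLp.toLp_add]
    refine MemLp.toLp_congr _ _ ?_
    have hb0 : ∀ z, ψ z = 0 → b z = 0 := fun z hz => by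
      rw [← norm_eq_zero, hb z, hz, norm_zero]
    filter_upwards [weighted_ae (Lp.coeFn_add f g) hb0] with z hz
    rw [hz]; simp [add_mul]
  map_smul' c f := by
    rw [RingHom.id_apply, ← MemLp.toLp_const_smul]
    refine MemLp.toLp_congr _ _ ?_
    have hb0 : ∀ z, ψ z = 0 → b z = 0 := fun z hz => by
      rw [← norm_eq_zero, hb z, hz, norm_zero]
    filter_upwards [weighted_ae (Lp.coeFn_smul c f) hb0] with z hz
    rw [hz]; simp [mul_assoc]
  norm_map' f := by
    change ‖(Lp.memLp_weighted_mul f b hb).toLp‖ = ‖f‖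
    rw [Lp.norm_toLp, eLpNorm_weightedMeasure ψ f hb, Lp.norm_def]

lemma coeFn_weightMul (ψ b : C(Circle, ℂ)) (hb : ∀ z, ‖b z‖ = ‖ψ z‖)
    (f : Lp ℂ 2 (weightedMeasure ψ)) :
    weightMul ψ b hb f =ᵐ[circleMeasure] fun z => f z * b z :=
  MemLp.coeFn_toLp (Lp.memLp_weighted_mul f b hb)

/-- The function `z ↦ zⁿ` on the circle. -/
def circlePow (n : ℤ) : C(Circle, ℂ) where
  toFun z := (z : ℂ) ^ n
  continuous_toFun := continuous_circle_coe.zpow₀ n fun z => Or.inl z.coe_ne_zero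

/-- The Fourier coefficients, as functionals on `L²`. -/
def coeffCLM (n : ℤ) : Lp ℂ 2 circleMeasure →L[ℂ] ℂ :=
  innerSL ℂ (ContinuousMap.toLp 2 circleMeasure ℂ (circlePow n))

lemma coeffCLM_apply (n : ℤ) (g : Lp ℂ 2 circleMeasure) : coeffCLM n g = circleCoeff g n := by
  rw [coeffCLM, innerSL_apply_apply, L2.inner_def, circleCoeff_eq_integral]
  refine integral_congr_ae ?_
  filter_upwards [ContinuousMap.coeFn_toLp (p := 2) (𝕜 := ℂ) circleMeasure (circlePow n)] with z hz
  rw [hz, RCLike.inner_apply, mul_comm]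
  congr 1
  change conj ((z : ℂ) ^ n) = _
  rw [map_zpow₀, Circle.conj_coe, inv_zpow, zpow_neg]

lemma coeffCLM_weightMul (n : ℤ) (ψ b : C(Circle, ℂ)) (hb : ∀ z, ‖b z‖ = ‖ψ z‖)
    (f : Lp ℂ 2 (weightedMeasure ψ)) :
    coeffCLM n (weightMul ψ b hb f) = circleCoeff (fun z => f z * b z) n := by
  rw [coeffCLM_apply, circleCoeff_congr (coeFn_weightMul ψ b hb f)]

/-- The conjugate of a continuous function. -/
def conjMap (ψ : C(Circle, ℂ)) : C(Circle, ℂ) where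
  toFun z := conj (ψ z)
  continuous_toFun := Complex.continuous_conj.comp ψ.continuous

lemma norm_conjMap (ψ : C(Circle, ℂ)) (z : Circle) : ‖conjMap ψ z‖ = ‖ψ z‖ :=
  RCLike.norm_conj _

lemma mem_hstarSubmodule_iff {ψ : C(Circle, ℂ)} {f : Lp ℂ 2 (weightedMeasure ψ)} :
    f ∈ hstarSubmodule ψ ↔ (∀ n : ℤ, n < 0 → circleCoeff (fun z => f z * ψ z) n = 0) ∧
      ∀ n : ℤ, 0 ≤ n → circleCoeff (fun z => f z * conj (ψ z)) n = 0 :=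
  ⟨fun h => ⟨h.1.2, h.2.2⟩, fun h => ⟨⟨Lp.memLp_weighted_mul f ψ fun _ => rfl, h.1⟩,
    ⟨Lp.memLp_weighted_mul f (conjMap ψ) (norm_conjMap ψ), h.2⟩⟩⟩

/-- Both defining conditions are vanishing of Fourier coefficients, which are continuous functionals
on the weighted space. -/
lemma isClosed_hstarSubmodule (ψ : C(Circle, ℂ)) :
    IsClosed (hstarSubmodule ψ : Set (Lp ℂ 2 (weightedMeasure ψ))) := by
  have h : (hstarSubmodule ψ : Set (Lp ℂ 2 (weightedMeasure ψ)))
      = (⋂ n : ℤ, ⋂ _ : n < 0, {f | coeffCLM n (weightMul ψ ψ (fun _ => rfl) f) = 0}) ∩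
        ⋂ n : ℤ, ⋂ _ : 0 ≤ n, {f | coeffCLM n (weightMul ψ (conjMap ψ) (norm_conjMap ψ) f) = 0} := by
    ext f
    simp only [SetLike.mem_coe, mem_hstarSubmodule_iff, Set.mem_inter_iff, Set.mem_iInter,
      Set.mem_ofPred_eq, coeffCLM_weightMul]
    rfl
  rw [h]
  refine IsClosed.inter ?_ ?_ <;>
  · refine isClosed_iInter fun n => isClosed_iInter fun _ => isClosed_eq ?_ continuous_const
    exact (coeffCLM n).continuous.comp (weightMul ψ _ _).continuous

instance Hstar.instCompleteSpace (ψ : C(Circle, ℂ)) : CompleteSpace (Hstar ψ) :=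
  (isClosed_hstarSubmodule ψ).completeSpace_coe

/-- The inclusion of `H_*` into the weighted `L²` space. -/
def Hstar.incl (ψ : C(Circle, ℂ)) : Hstar ψ →ₗᵢ[ℂ] Lp ℂ 2 (weightedMeasure ψ) :=
  (hstarSubmodule ψ).subtypeₗᵢ

/-- The isometry `f ↦ f ψ` from `H_*` to `L²(m)`. -/
def Hstar.mulWeight (ψ : C(Circle, ℂ)) : Hstar ψ →ₗᵢ[ℂ] Lp ℂ 2 circleMeasure :=
  (weightMul ψ ψ fun _ => rfl).comp (Hstar.incl ψ)

lemma Hstar.coeFn_mulWeight {ψ : C(Circle, ℂ)} (f : Hstar ψ) :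
    Hstar.mulWeight ψ f =ᵐ[circleMeasure] fun z => boundaryFun f z * ψ z :=
  coeFn_weightMul ψ ψ (fun _ => rfl) f.1

/-! ### The backward shift on the weighted space -/

lemma Lp.memLp_inv_mul {ν : Measure Circle} (f : Lp ℂ 2 ν) :
    MemLp (fun z : Circle => (z : ℂ)⁻¹ * f z) 2 ν :=
  (Lp.memLp f).of_le
    ((continuous_circle_coe.measurable.inv.stronglyMeasurable.mul
      (Lp.stronglyMeasurable f)).aestronglyMeasurable)
    (Filter.Eventually.of_forall fun z => by
      rw [norm_mul, norm_inv, Circle.norm_coe, inv_one, one_mul])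

/-- Multiplication by `z⁻¹` as an isometry of `L²`. -/
def invMul (ν : Measure Circle) : Lp ℂ 2 ν →ₗᵢ[ℂ] Lp ℂ 2 ν :=
  { toFun f := (Lp.memLp_inv_mul f).toLp
    map_add' f g := by
      rw [← MemLp.toLp_add]
      refine MemLp.toLp_congr _ _ ?_
      filter_upwards [Lp.coeFn_add f g] with z hz
      rw [hz]; simp [mul_add]
    map_smul' c f := by
      rw [RingHom.id_apply, ← MemLp.toLp_const_smul]
      refine MemLp.toLp_congr _ _ ?_
      filter_upwards [Lp.coeFn_smul c f] with z hz
      rw [hz]; simp [mul_left_comm]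
    norm_map' f := by
      change ‖(Lp.memLp_inv_mul f).toLp‖ = ‖f‖
      rw [Lp.norm_toLp, Lp.norm_def]
      congr 1
      refine eLpNorm_congr_norm_ae (Filter.Eventually.of_forall fun z => ?_)
      rw [norm_mul, norm_inv, Circle.norm_coe, inv_one, one_mul] }

lemma coeFn_invMul (ν : Measure Circle) (f : Lp ℂ 2 ν) :
    invMul ν f =ᵐ[ν] fun z : Circle => (z : ℂ)⁻¹ * f z :=
  MemLp.coeFn_toLp (Lp.memLp_inv_mul f)

instance weightedMeasure.isFiniteMeasure (ψ : C(Circle, ℂ)) :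
    IsFiniteMeasure (weightedMeasure ψ) := by
  refine isFiniteMeasure_withDensity (ne_of_lt ?_)
  have h : MemLp ψ 2 circleMeasure :=
    memLp_circle_of_continuous ψ.continuous
  have := lintegral_rpow_enorm_lt_top_of_eLpNorm_lt_top (by simp) (by simp) h.2
  simpa using this

/-- The functional `f ↦ f(0)`, where `w` stands for `φ(0)`. -/
def evalZero (ψ : C(Circle, ℂ)) (w : ℂ) : Lp ℂ 2 (weightedMeasure ψ) →L[ℂ] ℂ :=
  w⁻¹ • (coeffCLM 0).comp (weightMul ψ ψ fun _ => rfl).toContinuousLinearMap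

lemma evalZero_apply (ψ : C(Circle, ℂ)) (w : ℂ) (f : Lp ℂ 2 (weightedMeasure ψ)) :
    evalZero ψ w f = circleCoeff (fun z => f z * ψ z) 0 / w := by
  change w⁻¹ * coeffCLM 0 (weightMul ψ ψ (fun _ => rfl) f) = _
  rw [coeffCLM_weightMul, div_eq_inv_mul]

/-- The backward shift on the weighted space. -/
def shiftLp (ψ : C(Circle, ℂ)) (w : ℂ) :
    Lp ℂ 2 (weightedMeasure ψ) →L[ℂ] Lp ℂ 2 (weightedMeasure ψ) :=
  (invMul (weightedMeasure ψ)).toContinuousLinearMap - (evalZero ψ w).smulRight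
    (ContinuousMap.toLp 2 (weightedMeasure ψ) ℂ (circlePow (-1)))

lemma shiftLp_apply (ψ : C(Circle, ℂ)) (w : ℂ) (f : Lp ℂ 2 (weightedMeasure ψ)) :
    shiftLp ψ w f = invMul _ f - evalZero ψ w f •
      ContinuousMap.toLp 2 (weightedMeasure ψ) ℂ (circlePow (-1)) := rfl

lemma coeFn_shiftLp (ψ : C(Circle, ℂ)) (w : ℂ) (f : Lp ℂ 2 (weightedMeasure ψ)) :
    shiftLp ψ w f =ᵐ[weightedMeasure ψ] fun z => (f z - evalZero ψ w f) / z := by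
  rw [shiftLp_apply]
  filter_upwards [Lp.coeFn_sub (invMul _ f) (evalZero ψ w f •
      ContinuousMap.toLp 2 (weightedMeasure ψ) ℂ (circlePow (-1))), coeFn_invMul _ f,
    Lp.coeFn_smul (evalZero ψ w f)
      (ContinuousMap.toLp 2 (weightedMeasure ψ) ℂ (circlePow (-1))),
    ContinuousMap.coeFn_toLp (p := 2) (𝕜 := ℂ) (weightedMeasure ψ) (circlePow (-1))]
    with z h1 h2 h3 h4
  rw [h1, Pi.sub_apply, h2, h3, Pi.smul_apply, h4]
  change _ - evalZero ψ w f * (z : ℂ) ^ (-1 : ℤ) = _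
  rw [zpow_neg_one]
  ring

/-! ### Fourier coefficients of functions in the disc algebra -/

/-- Mean value property for `zⁿ h`; the factor `0 ^ n` treats the constant term and the negative
indices together. -/
lemma circleCoeff_of_nonpos {h : ℂ → ℂ} (hh : DiffContOnCl ℂ h (Metric.ball 0 1)) (n : ℕ) :
    circleCoeff (fun z => h z) (-n) = 0 ^ n * h 0 := by
  have hp : DiffContOnCl ℂ (fun z : ℂ => z ^ n) (Metric.ball 0 1) :=
    (differentiable_pow n).diffContOnCl
  rw [circleCoeff_eq_integral]
  have := (hp.smul hh).integral_circle
  simpa using this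

lemma circleCoeff_conj (g : Circle → ℂ) (n : ℤ) :
    circleCoeff (fun z => conj (g z)) n = conj (circleCoeff g (-n)) := by
  rw [circleCoeff_eq_integral, circleCoeff_eq_integral, ← integral_conj]
  refine integral_congr_ae (Filter.Eventually.of_forall fun z => ?_)
  simp only [map_mul, map_zpow₀, Circle.conj_coe, neg_neg, inv_zpow, zpow_neg]

lemma MemHardy.of_diffContOnCl {h : ℂ → ℂ} (hh : DiffContOnCl ℂ h (Metric.ball 0 1)) :
    MemHardy fun z => h z := by
  refine ⟨memLp_circle_of_continuous hh.continuous_circle, fun n hn => ?_⟩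
  obtain ⟨m, rfl⟩ := Int.exists_eq_neg_ofNat hn.le
  rw [circleCoeff_of_nonpos hh, zero_pow (by omega), zero_mul]

lemma MemHardyMinus.of_diffContOnCl {h : ℂ → ℂ} (hh : DiffContOnCl ℂ h (Metric.ball 0 1))
    (h0 : h 0 = 0) : MemHardyMinus fun z => conj (h z) := by
  refine ⟨memLp_circle_of_continuous
    (Complex.continuous_conj.comp hh.continuous_circle), fun n hn => ?_⟩
  obtain ⟨m, rfl⟩ := Int.eq_ofNat_of_zero_le hn
  rw [circleCoeff_conj, circleCoeff_of_nonpos hh, h0, mul_zero, map_zero]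

/-! ### Invertibility from a complete system of eigenvectors -/

lemma exists_finset_sum_of_mem_span_image {ι X : Type*} [AddCommGroup X] [Module ℂ X]
    {k : ι → X} {L : Set ι} {x : X} (hx : x ∈ Submodule.span ℂ (k '' L)) :
    ∃ (s : Finset ι) (a : ι → ℂ), (∀ l ∈ s, l ∈ L) ∧ x = ∑ l ∈ s, a l • k l := by
  obtain ⟨a, ha, rfl⟩ := (Finsupp.mem_span_image_iff_linearCombination ℂ).1 hx
  exact ⟨a.support, a, fun l hl => (Finsupp.mem_supported ℂ a).1 ha hl, rfl⟩

lemma sum_smul_mem_span_image {ι X : Type*} [AddCommGroup X] [Module ℂ X]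
    {k : ι → X} {L : Set ι} {s : Finset ι} (hs : ∀ l ∈ s, l ∈ L) (a : ι → ℂ) :
    ∑ l ∈ s, a l • k l ∈ Submodule.span ℂ (k '' L) :=
  Submodule.sum_mem _ fun l hl =>
    Submodule.smul_mem _ _ (Submodule.subset_span ⟨l, hs l hl, rfl⟩)

/-- If an operator has a complete system of eigenvectors and `T - μ` is bounded below on their span,
and `μ` is not one of the eigenvalues, then `T - μ` is invertible. -/
lemma bijective_sub_of_eigenvectors {ι X : Type*} [NormedAddCommGroup X] [NormedSpace ℂ X]
    [CompleteSpace X] (T : X →L[ℂ] X) {L : Set ι} (k : ι → X) (e : ι → ℂ)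
    (hT : ∀ l ∈ L, T (k l) = e l • k l)
    (hd : Dense (Submodule.span ℂ (k '' L) : Set X)) {μ : ℂ} (hμ : ∀ l ∈ L, e l ≠ μ) {C : ℝ}
    (hC : ∀ (s : Finset ι) (a : ι → ℂ), (∀ l ∈ s, l ∈ L) →
      ‖∑ l ∈ s, a l • k l‖ ^ 2 ≤ C * ‖∑ l ∈ s, (a l * (e l - μ)) • k l‖ ^ 2) :
    Function.Bijective (T - algebraMap ℂ (X →L[ℂ] X) μ) := by
  have hA : ∀ (s : Finset ι) (a : ι → ℂ), (∀ l ∈ s, l ∈ L) →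
      (T - algebraMap ℂ (X →L[ℂ] X) μ) (∑ l ∈ s, a l • k l)
        = ∑ l ∈ s, (a l * (e l - μ)) • k l := by
    intro s a hs
    rw [map_sum]
    refine Finset.sum_congr rfl fun l hl => ?_
    rw [map_smul, sub_apply, hT l (hs l hl), Algebra.algebraMap_eq_smul_one]
    change a l • (e l • k l - μ • k l) = _
    module
  -- The span is its own image, since each `e l - μ` is invertible. `C` has no assumed sign, hence
  -- `max C 0`.
  refine bijective_of_bounded_below _ hd (hd.mono ?_) √(max C 0) ?_
  · intro x hx
    obtain ⟨s, a, hs, rfl⟩ := exists_finset_sum_of_mem_span_image hx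
    refine ⟨∑ l ∈ s, (a l / (e l - μ)) • k l, sum_smul_mem_span_image hs _, ?_⟩
    rw [hA s _ hs]
    refine Finset.sum_congr rfl fun l hl => ?_
    rw [div_mul_cancel₀ _ (sub_ne_zero.2 (hμ l (hs l hl)))]
  · intro x hx
    obtain ⟨s, a, hs, rfl⟩ := exists_finset_sum_of_mem_span_image hx
    rw [hA s a hs]
    refine le_of_sq_le_sq ?_ (by positivity)
    rw [mul_pow, Real.sq_sqrt (le_max_right _ _)]
    refine (hC s a hs).trans ?_
    gcongr
    exact le_max_left _ _

/-! ### The backward shift and evaluation at the origin on `H_*` -/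

section

variable {φ : ℂ → ℂ} (hφ : ContDiffOn ℂ 1 φ (Metric.closedBall 0 1))

lemma ContDiffOn.diffContOnCl_ball (hφ : ContDiffOn ℂ 1 φ (Metric.closedBall 0 1)) :
    DiffContOnCl ℂ φ (Metric.ball 0 1) :=
  (hφ.differentiableOn (by norm_num)).diffContOnCl_ball subset_rfl

/-- Division by `z` moves the index by one; with `b` equal to `ψ` or its conjugate this serves both
halves of the definition of `H_*`. -/
lemma circleCoeff_shiftLp_mul (ψ b : C(Circle, ℂ)) (hb : ∀ z, ‖b z‖ = ‖ψ z‖) (w : ℂ)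
    (f : Lp ℂ 2 (weightedMeasure ψ)) (n : ℤ) :
    circleCoeff (fun z => shiftLp ψ w f z * b z) n
      = circleCoeff (fun z => f z * b z) (n + 1) - evalZero ψ w f * circleCoeff b (n + 1) := by
  have hb0 : ∀ z, ψ z = 0 → b z = 0 := fun z hz => by
    rw [← norm_eq_zero, hb z, hz, norm_zero]
  rw [circleCoeff_congr (weighted_ae (coeFn_shiftLp ψ w f) hb0)]
  have h1 : circleCoeff (fun z => (f z - evalZero ψ w f) / z * b z) n
      = circleCoeff ((fun z => f z * b z) + (-evalZero ψ w f) • (b : Circle → ℂ)) (n + 1) := by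
    rw [circleCoeff_eq_integral, circleCoeff_eq_integral]
    refine integral_congr_ae (Filter.Eventually.of_forall fun z => ?_)
    simp only [Pi.add_apply, Pi.smul_apply, smul_eq_mul]
    rw [neg_add, zpow_add₀ z.coe_ne_zero, zpow_neg_one]
    ring
  rw [h1, circleCoeff_add (Lp.memLp_weighted_mul f b hb)
    ((memLp_circle_of_continuous b.continuous).const_smul _), circleCoeff_smul]
  ring

/-- The delicate index is `n = -1`: there the zeroth coefficients of `f φ` and of `f(0) φ` cancel by
the definition of `f(0)`. Otherwise all coefficients involved vanish. -/
lemma shiftLp_mem (hc : DiffContOnCl ℂ φ (Metric.ball 0 1)) (hφ0 : φ 0 ≠ 0) {ψ : C(Circle, ℂ)}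
    (hψφ : (ψ : Circle → ℂ) = fun z : Circle => φ z) {f : Lp ℂ 2 (weightedMeasure ψ)}
    (hf : f ∈ hstarSubmodule ψ) : shiftLp ψ (φ 0) f ∈ hstarSubmodule ψ := by
  rw [mem_hstarSubmodule_iff] at hf ⊢
  constructor
  · intro n hn
    have hψc : ∀ m, circleCoeff ψ m = circleCoeff (fun z => φ z) m := fun m => by rw [hψφ]
    rw [circleCoeff_shiftLp_mul ψ ψ (fun _ => rfl), hψc]
    rcases (Int.add_one_le_of_lt hn).eq_or_lt with h | h
    · have h1 := circleCoeff_of_nonpos hc 0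
      simp only [Nat.cast_zero, neg_zero, pow_zero, one_mul] at h1
      rw [h, h1, evalZero_apply, div_mul_cancel₀ _ hφ0, sub_self]
    · obtain ⟨m, hm⟩ := Int.exists_eq_neg_ofNat h.le
      rw [hf.1 _ h, hm, circleCoeff_of_nonpos hc, zero_pow (by omega)]
      ring
  · intro n hn
    have h1 := circleCoeff_shiftLp_mul ψ (conjMap ψ) (norm_conjMap ψ) (φ 0) f n
    change circleCoeff (fun z => shiftLp ψ (φ 0) f z * conjMap ψ z) n = 0
    have h2 : circleCoeff (fun z => f z * conjMap ψ z) (n + 1) = 0 := hf.2 (n + 1) (by omega)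
    have h3 : circleCoeff (conjMap ψ) (n + 1) = 0 := by
      have := circleCoeff_conj (fun z => φ z) (n + 1)
      obtain ⟨m, hm⟩ := Int.eq_ofNat_of_zero_le (show 0 ≤ n + 1 by omega)
      have h4 : (conjMap ψ : Circle → ℂ) = fun z : Circle => conj (φ z) := by
        funext z
        exact congrArg conj (congrFun hψφ z)
      rw [h4, this, hm, circleCoeff_of_nonpos hc, zero_pow (by omega)]
      simp
    rw [h1, h2, h3]
    ring

/-- The backward shift on `H_*(φ, φ)`. -/
def Hstar.shift (hφ0 : φ 0 ≠ 0) : Hstar (boundaryValues φ hφ.continuousOn) →L[ℂ]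
    Hstar (boundaryValues φ hφ.continuousOn) :=
  ((shiftLp (boundaryValues φ hφ.continuousOn) (φ 0)).comp
    (hstarSubmodule (boundaryValues φ hφ.continuousOn)).subtypeL).codRestrict
    (hstarSubmodule (boundaryValues φ hφ.continuousOn)) fun f =>
      shiftLp_mem hφ.diffContOnCl_ball hφ0 rfl f.2

/-- Evaluation at the origin on `H_*(φ, φ)`. -/
def Hstar.eval : Hstar (boundaryValues φ hφ.continuousOn) →L[ℂ] ℂ :=
  (evalZero (boundaryValues φ hφ.continuousOn) (φ 0)).comp
    (Hstar.incl (boundaryValues φ hφ.continuousOn)).toContinuousLinearMap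

lemma Hstar.eval_apply (f : Hstar (boundaryValues φ hφ.continuousOn)) :
    Hstar.eval hφ f = valueAtZero φ (boundaryFun f) :=
  evalZero_apply _ _ f.1

/-- When `f(0) = 0` the shift is multiplication by the unimodular function `1/z`. -/
lemma Hstar.norm_shift (hφ0 : φ 0 ≠ 0) (f : Hstar (boundaryValues φ hφ.continuousOn))
    (hf : Hstar.eval hφ f = 0) : ‖Hstar.shift hφ hφ0 f‖ = ‖f‖ := by
  have h1 : (Hstar.shift hφ hφ0 f).1 = invMul _ f.1 := by
    change shiftLp _ (φ 0) f.1 = _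
    have h2 : evalZero (boundaryValues φ hφ.continuousOn) (φ 0) f.1 = 0 := hf
    rw [shiftLp_apply, h2, zero_smul, sub_zero]
  calc ‖Hstar.shift hφ hφ0 f‖ = ‖(Hstar.shift hφ hφ0 f).1‖ := rfl
    _ = ‖f.1‖ := by rw [h1, LinearIsometry.norm_map]
    _ = ‖f‖ := rfl

variable {E : Set Circle}

lemma ae_of_ae_weighted (hzero : ∀ z : Circle, φ z = 0 ↔ z ∈ E) (hE : circleMeasure E = 0)
    {p : Circle → Prop} (h : ∀ᵐ z ∂weightedMeasure (boundaryValues φ hφ.continuousOn), p z) :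
    ∀ᵐ z ∂circleMeasure, p z := by
  have hm : Measurable fun z => ‖boundaryValues φ hφ.continuousOn z‖ₑ ^ 2 :=
    ((boundaryValues φ hφ.continuousOn).continuous.measurable.enorm).pow_const 2
  have h' := (ae_withDensity_iff hm).1 h
  filter_upwards [h', measure_eq_zero_iff_ae_notMem.1 hE] with z hz hzE
  have h0 : boundaryValues φ hφ.continuousOn z ≠ 0 := mt (hzero z).1 hzE
  exact hz (by simpa using h0)

lemma Hstar.ext_ae {ψ : C(Circle, ℂ)} {f g : Hstar ψ}
    (h : boundaryFun f =ᵐ[circleMeasure] boundaryFun g) : f = g :=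
  Subtype.ext (Lp.ext ((withDensity_absolutelyContinuous _ _).ae_eq h))

lemma Hstar.boundaryFun_shift (hφ0 : φ 0 ≠ 0) (hzero : ∀ z : Circle, φ z = 0 ↔ z ∈ E)
    (hE : circleMeasure E = 0) (f : Hstar (boundaryValues φ hφ.continuousOn)) :
    boundaryFun (Hstar.shift hφ hφ0 f) =ᵐ[circleMeasure] backwardShift φ (boundaryFun f) := by
  refine ae_of_ae_weighted hφ hzero hE ?_
  filter_upwards [coeFn_shiftLp (boundaryValues φ hφ.continuousOn) (φ 0) f.1] with z hz
  change shiftLp (boundaryValues φ hφ.continuousOn) (φ 0) f.1 z = _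
  rw [hz, backwardShift, ← Hstar.eval_apply hφ]
  rfl

/-! ### The Cauchy kernels in `H_*(φ, φ)` -/

lemma ae_ne_of_mem (hE : circleMeasure E = 0) {l : Circle} (hl : l ∈ E) :
    ∀ᵐ z : Circle ∂circleMeasure, (z : ℂ) ≠ l := by
  filter_upwards [measure_eq_zero_iff_ae_notMem.1 hE] with z hz h
  exact hz (Circle.coe_injective h ▸ hl)

lemma exists_isCauchyKernel (hzero : ∀ z : Circle, φ z = 0 ↔ z ∈ E)
    (hE : circleMeasure E = 0) {l : Circle} (hl : l ∈ E) :
    ∃ f : Hstar (boundaryValues φ hφ.continuousOn), IsCauchyKernel f l := by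
  set ψ := boundaryValues φ hφ.continuousOn with hψ
  have hψφ : ∀ z : Circle, ψ z = φ z := fun z => rfl
  have hq := diffContOnCl_diffQuot hφ l ((hzero l).2 hl)
  have hne := ae_ne_of_mem hE hl
  set k : Circle → ℂ := fun z => 1 / ((z : ℂ) - l) with hk
  have hkm : Measurable k := measurable_const.div (continuous_circle_coe.measurable.sub_const _)
  have h1 : (fun z : Circle => diffQuot φ l z) =ᵐ[circleMeasure] fun z => k z * ψ z := by
    filter_upwards [hne] with z hz
    rw [diffQuot_of_ne φ hz, hk, hψφ]; ring
  have hmem : MemLp k 2 (weightedMeasure ψ) := by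
    refine ⟨hkm.aestronglyMeasurable, ?_⟩
    rw [← eLpNorm_weightedMeasure ψ k fun _ => rfl]
    exact ((MemHardy.of_diffContOnCl hq).congr h1).1.2
  have hco := MemLp.coeFn_toLp hmem
  have hH : MemHardy fun z => hmem.toLp k z * ψ z :=
    ((MemHardy.of_diffContOnCl hq).congr h1).congr (weighted_ae hco fun _ h => h).symm
  -- On the circle `conj φ / (z - l)` is the conjugate of `-l z φ / (z - l)`, whose factor `z`
  -- supplies the zero at the origin required for `H²₋`.
  have hid : DiffContOnCl ℂ (fun z : ℂ => -(l * z)) (Metric.ball 0 1) :=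
    ((differentiable_id.const_mul (l : ℂ)).neg).diffContOnCl
  have hM : MemHardyMinus fun z => hmem.toLp k z * conj (ψ z) := by
    refine (MemHardyMinus.of_diffContOnCl (hid.smul hq) (by simp)).congr
      (Filter.EventuallyEq.trans ?_
        (weighted_ae hco (b := fun z => conj (ψ z)) fun _ h => by simp [h]).symm)
    filter_upwards [hne] with z hz
    rw [diffQuot_of_ne φ hz, hk, hψφ]
    simp only [smul_eq_mul, map_mul, map_neg, map_div₀, map_sub, Circle.conj_coe]
    have h2 : (z : ℂ) - l ≠ 0 := sub_ne_zero.2 hz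
    have h3 : (l : ℂ) - z ≠ 0 := sub_ne_zero.2 hz.symm
    have hz0 := z.coe_ne_zero
    have hl0 := l.coe_ne_zero
    have h4 : (z : ℂ)⁻¹ - (l : ℂ)⁻¹ = -((z - l) / (z * l)) := by field_simp; ring
    rw [h4]
    field_simp
  exact ⟨⟨hmem.toLp k, hH, hM⟩, ae_of_ae_weighted hφ hzero hE hco⟩

lemma IsCauchyKernel.unique {ψ : C(Circle, ℂ)} {f g : Hstar ψ} {l : Circle}
    (hf : IsCauchyKernel f l) (hg : IsCauchyKernel g l) : f = g :=
  Hstar.ext_ae (hf.trans hg.symm)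

lemma IsCauchyKernel.mulWeight {f : Hstar (boundaryValues φ hφ.continuousOn)} {l : Circle}
    (hE : circleMeasure E = 0) (hl : l ∈ E) (hf : IsCauchyKernel f l) :
    Hstar.mulWeight _ f =ᵐ[circleMeasure] fun z : Circle => diffQuot φ l z := by
  filter_upwards [Hstar.coeFn_mulWeight f, hf, ae_ne_of_mem hE hl] with z h1 h2 h3
  rw [h1, h2, diffQuot_of_ne φ h3]
  change 1 / ((z : ℂ) - l) * φ z = _
  ring

lemma IsCauchyKernel.eval {f : Hstar (boundaryValues φ hφ.continuousOn)} {l : Circle}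
    (hφ0 : φ 0 ≠ 0) (hzero : ∀ z : Circle, φ z = 0 ↔ z ∈ E) (hE : circleMeasure E = 0)
    (hl : l ∈ E) (hf : IsCauchyKernel f l) : Hstar.eval hφ f = -conj (l : ℂ) := by
  have h1 := circleCoeff_of_nonpos (diffContOnCl_diffQuot hφ l ((hzero l).2 hl)) 0
  simp only [Nat.cast_zero, neg_zero, pow_zero, one_mul] at h1
  rw [Hstar.eval_apply, valueAtZero]
  have h2 : (fun z : Circle => boundaryFun f z * φ z) =ᵐ[circleMeasure]
      fun z : Circle => diffQuot φ l z :=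
    (Hstar.coeFn_mulWeight f).symm.trans (hf.mulWeight hφ hE hl)
  rw [circleCoeff_congr h2, h1, diffQuot_of_ne φ l.coe_ne_zero.symm, Circle.conj_coe]
  have := l.coe_ne_zero
  field_simp
  simp

/-- The value at `0` is `-conj l`, and `1 + conj l * (z - l) = conj l * z` on account of `|l| = 1`.
-/
lemma IsCauchyKernel.shift {f : Hstar (boundaryValues φ hφ.continuousOn)} {l : Circle}
    (hφ0 : φ 0 ≠ 0) (hzero : ∀ z : Circle, φ z = 0 ↔ z ∈ E) (hE : circleMeasure E = 0)
    (hl : l ∈ E) (hf : IsCauchyKernel f l) :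
    Hstar.shift hφ hφ0 f = conj (l : ℂ) • f := by
  refine Hstar.ext_ae ?_
  have hs : boundaryFun (conj (l : ℂ) • f) =ᵐ[circleMeasure] conj (l : ℂ) • boundaryFun f :=
    ae_of_ae_weighted hφ hzero hE (Lp.coeFn_smul (conj (l : ℂ)) f.1)
  filter_upwards [Hstar.boundaryFun_shift hφ hφ0 hzero hE f, hs, hf, ae_ne_of_mem hE hl]
    with z h1 h2 h3 h4
  rw [h1, h2, backwardShift, ← Hstar.eval_apply hφ, hf.eval hφ hφ0 hzero hE hl, Pi.smul_apply, h3,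
    Circle.conj_coe, smul_eq_mul]
  have hz0 := z.coe_ne_zero
  have hl0 := l.coe_ne_zero
  have h5 : (z : ℂ) - l ≠ 0 := sub_ne_zero.2 h4
  field_simp
  ring

lemma Lp.norm_sq_eq_integral (g : Lp ℂ 2 circleMeasure) :
    ‖g‖ ^ 2 = ∫ z, ‖g z‖ ^ 2 ∂circleMeasure := by
  have h := L2.inner_def (𝕜 := ℂ) g g
  rw [inner_self_eq_norm_sq_to_K] at h
  have h2 : ∫ z, inner ℂ (g z) (g z) ∂circleMeasure
      = ((∫ z, ‖g z‖ ^ 2 ∂circleMeasure : ℝ) : ℂ) := by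
    rw [← integral_complex_ofReal]
    refine integral_congr_ae (Filter.Eventually.of_forall fun z => ?_)
    simp [inner_self_eq_norm_sq_to_K]
  rw [h2] at h
  exact Complex.ofReal_injective (by rw [← h]; simp)

lemma norm_sq_sum_cauchyKernel (hE : circleMeasure E = 0)
    {k : Circle → Hstar (boundaryValues φ hφ.continuousOn)}
    (hk : ∀ l ∈ E, IsCauchyKernel (k l) l) (s : Finset Circle) (a : Circle → ℂ)
    (hs : ∀ l ∈ s, l ∈ E) :
    ‖∑ l ∈ s, a l • k l‖ ^ 2 = ∫ z : Circle, ‖kernelSum φ s a z‖ ^ 2 ∂circleMeasure := by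
  classical
  have h : Hstar.mulWeight _ (∑ l ∈ s, a l • k l) =ᵐ[circleMeasure]
      fun z : Circle => kernelSum φ s a z := by
    refine Finset.induction_on' (motive := fun t =>
      Hstar.mulWeight _ (∑ l ∈ t, a l • k l) =ᵐ[circleMeasure]
        fun z : Circle => kernelSum φ t a z) s ?_ ?_
    · rw [Finset.sum_empty, map_zero]
      filter_upwards [Lp.coeFn_zero ℂ 2 circleMeasure] with z hz
      rw [hz]; simp [kernelSum]
    · intro l t hl _ hlt ih
      rw [Finset.sum_insert hlt, map_add, map_smul]
      filter_upwards [ih, Lp.coeFn_add (a l • Hstar.mulWeight _ (k l))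
        (Hstar.mulWeight _ (∑ l ∈ t, a l • k l)), Lp.coeFn_smul (a l) (Hstar.mulWeight _ (k l)),
        (hk l (hs l hl)).mulWeight hφ hE (hs l hl)] with z h1 h2 h3 h4
      rw [h2, Pi.add_apply, h1, h3, Pi.smul_apply, h4, kernelSum, kernelSum,
        Finset.sum_insert hlt, smul_eq_mul]
  rw [← (Hstar.mulWeight _).norm_map, Lp.norm_sq_eq_integral]
  refine integral_congr_ae ?_
  filter_upwards [h] with z hz
  rw [hz]

/-- The Cauchy kernel depends continuously on its pole. -/
lemma continuousOn_cauchyKernel (hzero : ∀ z : Circle, φ z = 0 ↔ z ∈ E)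
    (hE : circleMeasure E = 0) {k : Circle → Hstar (boundaryValues φ hφ.continuousOn)}
    (hk : ∀ l ∈ E, IsCauchyKernel (k l) l) : ContinuousOn k E := by
  intro l hl
  obtain ⟨C, hC0, hC⟩ := exists_norm_diffQuot_le hφ
  have hn : ∀ v ∈ E, ‖k v - k l‖ ^ 2
      = ∫ z : Circle, ‖diffQuot φ v z - diffQuot φ l z‖ ^ 2 ∂circleMeasure := by
    intro v hv
    rw [← (Hstar.mulWeight _).norm_map, map_sub, Lp.norm_sq_eq_integral]
    refine integral_congr_ae ?_
    filter_upwards [Lp.coeFn_sub (Hstar.mulWeight _ (k v)) (Hstar.mulWeight _ (k l)),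
      (hk v hv).mulWeight hφ hE hv, (hk l hl).mulWeight hφ hE hl] with z h1 h2 h3
    rw [h1, Pi.sub_apply, h2, h3]
  have hlim : Filter.Tendsto
      (fun v : Circle => ∫ z : Circle, ‖diffQuot φ v z - diffQuot φ l z‖ ^ 2 ∂circleMeasure)
      (nhdsWithin l E) (nhds (∫ _ : Circle, (0 : ℝ) ∂circleMeasure)) := by
    -- The difference quotients are bounded by `C` uniformly in the pole and converge at each `z ≠
    -- l`.
    refine tendsto_integral_filter_of_dominated_convergence (fun _ => (2 * C) ^ 2) ?_ ?_
      (integrable_const _) ?_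
    · filter_upwards [self_mem_nhdsWithin] with v hv
      exact (((diffContOnCl_diffQuot hφ v ((hzero v).2 hv)).continuous_circle.sub
        (diffContOnCl_diffQuot hφ l ((hzero l).2 hl)).continuous_circle).norm.pow
          2).aestronglyMeasurable
    · filter_upwards [self_mem_nhdsWithin] with v hv
      refine Filter.Eventually.of_forall fun z => ?_
      rw [norm_pow, norm_norm]
      gcongr
      refine (norm_sub_le _ _).trans ?_
      rw [two_mul]
      exact add_le_add (hC v ((hzero v).2 hv) z (circle_coe_mem_closedBall z))
        (hC l ((hzero l).2 hl) z (circle_coe_mem_closedBall z))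
    · filter_upwards [ae_ne_of_mem hE hl] with z hz
      have h1 : Filter.Tendsto (fun v : Circle => φ z / ((z : ℂ) - v)) (nhdsWithin l E)
          (nhds (φ z / ((z : ℂ) - l))) :=
        (tendsto_const_nhds.div (tendsto_const_nhds.sub continuous_circle_coe.continuousAt)
          (sub_ne_zero.2 hz)).mono_left nhdsWithin_le_nhds
      have h2 : ∀ᶠ v : Circle in nhdsWithin l E,
          φ z / ((z : ℂ) - v) = diffQuot φ v z := by
        have : ∀ᶠ v : Circle in nhds l, (v : ℂ) ≠ z :=
          continuous_circle_coe.continuousAt.eventually_ne hz.symm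
        filter_upwards [nhdsWithin_le_nhds this] with v hv
        rw [diffQuot_of_ne φ hv.symm]
      have h3 := ((h1.congr' h2).sub_const (diffQuot φ l z)).norm.pow 2
      rw [diffQuot_of_ne φ hz, sub_self, norm_zero, zero_pow two_ne_zero,
        ← diffQuot_of_ne φ hz] at h3
      exact h3
  rw [integral_zero] at hlim
  rw [ContinuousWithinAt, tendsto_iff_norm_sub_tendsto_zero]
  have h4 : Filter.Tendsto (fun v => ‖k v - k l‖ ^ 2) (nhdsWithin l E) (nhds 0) := by
    refine hlim.congr' ?_
    filter_upwards [self_mem_nhdsWithin] with v hv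
    rw [hn v hv]
  have h5 := h4.sqrt
  simpa [Real.sqrt_sq] using h5

end

end

/-! ### The main theorem -/

/-- `T` below is the restriction of the backward shift to `H₀`; it is unique, and its existence
(i.e. the invariance of `H₀` and boundedness) is part of the claim, as is the fact that the Cauchy
kernels spanning `H₀` do belong to `H_*(φ, φ)`. -/
theorem theorem3p1 (E : Set Circle) (hE : Perfect E) (hCarleson : IsCarlesonSet E)
    (φ : ℂ → ℂ) (hφ : ContDiffOn ℂ 1 φ (Metric.closedBall 0 1)) (hφ0 : φ 0 ≠ 0)
    (hzero : {z : Circle | φ z = 0} = E)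
    (L : Set Circle) (hLE : L ⊆ E) (hLne : L.Nonempty) (hLc : L.Countable) (hL : Preperfect L) :
    (∀ lam ∈ E, ∃ f : Hstar (boundaryValues φ hφ.continuousOn), IsCauchyKernel f lam) ∧
    ∃ T : cauchySpan (boundaryValues φ hφ.continuousOn) L →L[ℂ]
        cauchySpan (boundaryValues φ hφ.continuousOn) L,
      (∀ f, boundaryFun (T f).1
        =ᵐ[circleMeasure] backwardShift φ (boundaryFun f.1)) ∧
      IsHypercyclic T ∧ IsRankOnePerturbationOfUnitary T ∧
      (E ⊆ closure L →
        spectrum ℂ T = (fun z : Circle => conj (z : ℂ)) '' E ∧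
        pointSpectrum T = (fun z : Circle => conj (z : ℂ)) '' E) := by
  have hm : circleMeasure E = 0 := hCarleson.2.1
  have hz : ∀ z : Circle, φ z = 0 ↔ z ∈ E := fun z => by rw [← hzero]; rfl
  have hker : ∀ l ∈ E, ∃ f : Hstar (boundaryValues φ hφ.continuousOn), IsCauchyKernel f l :=
    fun l hl => exists_isCauchyKernel hφ hz hm hl
  refine ⟨hker, ?_⟩
  have hk' : ∃ k : Circle → Hstar (boundaryValues φ hφ.continuousOn),
      ∀ l ∈ E, IsCauchyKernel (k l) l := by
    choose f hf using hker
    classical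
    exact ⟨fun l => if h : l ∈ E then f l h else 0, fun l hl => by simpa [hl] using hf l hl⟩
  obtain ⟨k, hk⟩ := hk'
  set X := cauchySpan (boundaryValues φ hφ.continuousOn) L with hX
  have hkc := continuousOn_cauchyKernel hφ hz hm hk
  have hset : {f : Hstar (boundaryValues φ hφ.continuousOn) | ∃ l ∈ L, IsCauchyKernel f l}
      = k '' L := by
    ext f
    constructor
    · rintro ⟨l, hl, hf⟩
      exact ⟨l, hl, (hk l (hLE hl)).unique hf⟩
    · rintro ⟨l, hl, rfl⟩
      exact ⟨l, hl, hk l (hLE hl)⟩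
  have hXs : X = (Submodule.span ℂ (k '' L)).topologicalClosure := by
    rw [hX, cauchySpan, hset]
  have hXcl : IsClosed (X : Set (Hstar (boundaryValues φ hφ.continuousOn))) := by
    rw [hXs]; exact Submodule.isClosed_topologicalClosure _
  have hXc : CompleteSpace X := hXcl.completeSpace_coe
  have hkX : ∀ l ∈ L, k l ∈ X := fun l hl => by
    rw [hXs]
    exact Submodule.le_topologicalClosure _ (Submodule.subset_span ⟨l, hl, rfl⟩)
  have hS : ∀ l ∈ E, Hstar.shift hφ hφ0 (k l) = conj (l : ℂ) • k l := fun l hl =>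
    (hk l hl).shift hφ hφ0 hz hm hl
  have hinv : ∀ f ∈ X, Hstar.shift hφ hφ0 f ∈ X := by
    have h1 : Submodule.span ℂ (k '' L) ≤
        X.comap (Hstar.shift hφ hφ0 : Hstar _ →ₗ[ℂ] Hstar _) := by
      rw [Submodule.span_le]
      rintro _ ⟨l, hl, rfl⟩
      change Hstar.shift hφ hφ0 (k l) ∈ X
      rw [hS l (hLE hl)]
      exact X.smul_mem _ (hkX l hl)
    have h2 : X ≤ X.comap (Hstar.shift hφ hφ0 : Hstar _ →ₗ[ℂ] Hstar _) := by
      conv_lhs => rw [hXs]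
      exact Submodule.topologicalClosure_minimal _ h1
        (hXcl.preimage (Hstar.shift hφ hφ0).continuous)
    exact h2
  set T : X →L[ℂ] X := ((Hstar.shift hφ hφ0).comp X.subtypeL).codRestrict X
    fun f => hinv f.1 f.2 with hT
  have hTf : ∀ f, (T f).1 = Hstar.shift hφ hφ0 f.1 := fun f => rfl
  classical
  -- The default `0` is harmless: kernels with poles in `L` lie in `X`, and those with poles in `E`
  -- do once `L` is dense in `E`.
  set kX : Circle → X := fun l => if h : k l ∈ X then ⟨k l, h⟩ else 0 with hkXdef
  have hkXv : ∀ l, k l ∈ X → (kX l).1 = k l := fun l hl => by simp [hkXdef, hl]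
  have hTk : ∀ l ∈ E, k l ∈ X → T (kX l) = conj (l : ℂ) • kX l := fun l hl hlX => by
    refine Subtype.ext ?_
    rw [hTf, Submodule.coe_smul, hkXv l hlX, hS l hl]
  have hTkL : ∀ l ∈ L, T (kX l) = conj (l : ℂ) • kX l := fun l hl =>
    hTk l (hLE hl) (hkX l hl)
  have hkXc : ContinuousOn kX L := by
    rw [Topology.IsInducing.subtypeVal.continuousOn_iff]
    exact (hkc.mono hLE).congr fun l hl => hkXv l (hkX l hl)
  have hdense : Dense (Submodule.span ℂ (kX '' L) : Set X) := by
    have himg : (Subtype.val '' (Submodule.span ℂ (kX '' L) : Set X))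
        = (Submodule.span ℂ (k '' L) : Set (Hstar (boundaryValues φ hφ.continuousOn))) := by
      have h1 := Submodule.map_span X.subtype (kX '' L)
      have h2 : X.subtype '' (kX '' L) = k '' L := by
        rw [Set.image_image]
        exact Set.image_congr fun l hl => hkXv l (hkX l hl)
      rw [h2] at h1
      rw [← h1]
      rfl
    intro x
    rw [Topology.IsInducing.subtypeVal.closure_eq_preimage_closure_image]
    change x.1 ∈ closure (Subtype.val '' (Submodule.span ℂ (kX '' L) : Set X))
    rw [himg]
    exact hXs.le x.2
  -- The lower bound holds for all poles in `E`, hence on the span over `L`; this step needs no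
  -- density of `L` in `E`.
  have hbij : ∀ μ : ℂ, (∀ l ∈ E, conj (l : ℂ) ≠ μ) →
      Function.Bijective (T - algebraMap ℂ (X →L[ℂ] X) μ) := by
    intro μ hμ
    obtain ⟨C, hC⟩ := exists_integral_sq_norm_kernelSum_le hφ hφ0 hz hm hμ
    refine bijective_sub_of_eigenvectors T kX (fun l => conj (l : ℂ)) hTkL hdense
      (fun l hl => hμ l (hLE hl)) (C := C) fun s a hs => ?_
    have hn : ∀ a : Circle → ℂ, ‖∑ l ∈ s, a l • kX l‖ ^ 2
        = ∫ z : Circle, ‖kernelSum φ s a z‖ ^ 2 ∂circleMeasure := fun a => by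
      rw [← norm_sq_sum_cauchyKernel hφ hm hk s a fun l hl => hLE (hs l hl), Submodule.coe_norm,
        Submodule.coe_sum]
      congr 2
      refine Finset.sum_congr rfl fun l hl => ?_
      rw [Submodule.coe_smul, hkXv l (hkX l (hs l hl))]
    rw [hn, hn]
    exact hC s a fun l hl => hLE (hs l hl)
  refine ⟨T, fun f => Hstar.boundaryFun_shift hφ hφ0 hz hm f.1,
    isHypercyclic_of_eigenvectors T hLc hL kX hkXc hTkL hdense, ?_, fun hdL => ?_⟩
  · have hT0 := hbij 0 fun l _ => by simp
    rw [map_zero, sub_zero] at hT0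
    refine isRankOnePerturbationOfUnitary_of_ker T hT0 ((Hstar.eval hφ).comp X.subtypeL) ?_
      fun f hf => Hstar.norm_shift hφ hφ0 f.1 hf
    obtain ⟨l, hl⟩ := hLne
    intro h
    have h1 := congrArg (fun ℓ : X →L[ℂ] ℂ => ℓ ⟨k l, hkX l hl⟩) h
    change Hstar.eval hφ (k l) = 0 at h1
    rw [(hk l (hLE hl)).eval hφ hφ0 hz hm (hLE hl)] at h1
    simp at h1
  · have hkXE : ∀ l ∈ E, k l ∈ X := fun l hl => by
      -- Density of `L` in `E` and continuity of `k` make each kernel with pole in `E` a limit of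
      -- kernels with poles in `L`.
      have h1 : k l ∈ closure (k '' L) :=
        ((hkc l hl).mono hLE).mem_closure_image (hdL hl)
      rw [hXs]
      exact closure_mono Submodule.subset_span h1
    have hpoint : (fun z : Circle => conj (z : ℂ)) '' E ⊆ pointSpectrum T := by
      rintro _ ⟨l, hl, rfl⟩
      refine Module.End.hasEigenvalue_of_hasEigenvector (x := kX l)
        ⟨Module.End.mem_eigenspace_iff.2 (hTk l hl (hkXE l hl)), fun h0 => ?_⟩
      have h1 := congrArg Subtype.val h0
      rw [hkXv l (hkXE l hl)] at h1
      -- The kernel is nonzero because its value at the origin is `-conj l`.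
      have h2 := (hk l hl).eval hφ hφ0 hz hm hl
      rw [h1] at h2
      change Hstar.eval hφ 0 = _ at h2
      rw [map_zero] at h2
      simp at h2
    have hps : pointSpectrum T ⊆ spectrum ℂ T := by
      intro μ hμ hres
      obtain ⟨x, hx, hx0⟩ := Module.End.HasEigenvalue.exists_hasEigenvector hμ
      have hinj := (ContinuousLinearMap.isUnit_iff_bijective.1 hres).1
      refine hx0 (hinj ?_)
      rw [map_zero, sub_apply, Algebra.algebraMap_eq_smul_one]
      change μ • x - T x = 0
      rw [← Module.End.mem_eigenspace_iff.1 hx]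
      exact sub_self _
    have hsE : spectrum ℂ T ⊆ (fun z : Circle => conj (z : ℂ)) '' E := by
      intro μ hμ
      by_contra hcon
      refine hμ ?_
      have h1 := hbij μ fun l hl h => hcon ⟨l, hl, h⟩
      have h2 := (ContinuousLinearMap.isUnit_iff_bijective.2 h1).neg
      rwa [neg_sub] at h2
    exact ⟨hsE.antisymm (hpoint.trans hps), (hps.trans hsE).antisymm hpoint⟩
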